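/- **Setting.** Let $m,n\in\mathbb N$, $0<\alpha<mn$, $0<\gamma\le 1$, $0<\delta<\min\{\gamma,(mn-\alpha)/m\}$, $\tilde\alpha=\alpha+m\delta$ and $\tilde\delta\le\delta$. A *weight* is a positive (a.e.), locally integrable function on $\mathbb R^n$. Let $K:\mathbb R^n\times(\mathbb R^n)^m\to\mathbb R$ be measurable and satisfy $$|K(x,\vec y)|\lesssim \Big(\sum_{i=1}^m|x-y_i|\Big)^{-(mn-\alpha)}\quad\text{whenever } \sum_i|x-y_i|>0,$$ $$|K(x,\vec y)-K(x',\vec y)|\lesssim \frac{|x-x'|^\gamma}{\big(\sum_{i}|x-y_i|\big)^{mn-\alpha+\gamma}}\quad\text{whenever } \sum_i|x-y_i|>2|x-x'|,$$ and put $T\vec f(x)=\int_{(\mathbb R^n)^m}K(x,\vec y)\prod_{i=1}^m f_i(y_i)\,d\vec y$. Let $b_1,\dots,b_m\in\Lambda(\delta)$, i.e. $|b_i(x)-b_i(y)|\le A|x-y|^\delta$ for all $x,y$ and some constant $A$. With $[b,S]_j\vec f=b\,S\vec f-S(f_1,\dots,bf_j,\dots,f_m)$, the product commutator is $$\mathcal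 T_{\mathbf b}=[b_m,\dots[b_2,[b_1,T]_1]_2\dots]_m .$$ It is *defined at $\vec f$* if for each of the $2^m$ choices $g_i\in\{f_i,b_if_i\}$ the integral defining $T(g_1,\dots,g_m)(x)$ converges absolutely for a.e. $x$. In that case $\mathcal T_{\mathbf b}\vec f(x)=\int F_{\vec f}(x,\vec y)\,d\vec y$ for a.e. $x$, where $$F_{\vec f}(x,\vec y)=K(x,\vec y)\prod_{i=1}^m(b_i(x)-b_i(y_i))f_i(y_i).$$ Let $1\le p_i\le\infty$, let $p_i'$ be the conjugate exponents, $1/p=\sum_i1/p_i$, and assume $p>n/\tilde\alpha$. Let $w,v_1,\dots,v_m$ be weights with $(w,\vec v)\in\mathbb H_m(\vec p,\tilde\alpha,\tilde\delta)$: there are numbers $0<\tilde\alpha_i<n$ with $\sum_i\tilde\alpha_i=\tilde\alpha$ and a constant $A$ such that for every ball $B=B(x_B,R)$ $$\frac{\|w\chi_B\|_\infty}{|B|^{(\tilde\delta-\delta)/n}}\prod_{i=1}^m\left\|\frac{v_i^{-1}}{(|B|^{1/n}+|x_B-\cdot|)^{n-\tilde\alpha_i+\delta/m}}\right\|_{L^{p_i'}(\mathbb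 R^n)}\le A .$$ Assume also that $v_i^{-p_i'}\in\mathrm{RH}_m$ for every $i$ with $1<p_i\le\infty$, where $u\in\mathrm{RH}_m$ means $\big(\frac1{|B|}\int_Bu^m\big)^{1/m}\le \frac{A}{|B|}\int_Bu$ for all balls $B$ and some constant $A$ (no condition if $m=1$). **Theorem 1.2.** The commutator $\mathcal T_{\mathbf b}$ is bounded from $\prod_{i=1}^mL^{p_i}(v_i^{p_i})$ into $\mathbb L_w(\tilde\delta)$. That is, there is a constant $C>0$ such that the following holds for every $\vec f$ with $f_iv_i\in L^{p_i}$, $1\le i\le m$. 1. If $\mathcal T_{\mathbf b}$ is defined at $\vec f$, then $g=\mathcal T_{\mathbf b}\vec f$ is locally integrable and, for every ball $B$, with $g_B=\frac1{|B|}\int_Bg$, $$\frac{\|w\chi_B\|_\infty}{|B|^{1+\tilde\delta/n}}\int_B|g(x)-g_B|\,dx\le C\prod_{i=1}^m\|f_iv_i\|_{L^{p_i}}.\tag{$*$}$$ 2. In general, where the integrals above may diverge at infinity, $\mathcal T_{\mathbf b}\vec f$ is understood modulo additive constants: for a.e. $z$, the function $F_{\vec f}(x,\cdot)-F_{\vec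 f}(z,\cdot)$ is integrable on $(\mathbb R^n)^m$ for a.e. $x$, and $$g(x)=\int_{(\mathbb R^n)^m}\big(F_{\vec f}(x,\vec y)-F_{\vec f}(z,\vec y)\big)\,d\vec y$$ (which is $\mathcal T_{\mathbf b}\vec f(x)-\mathcal T_{\mathbf b}\vec f(z)$ when the latter are given by convergent integrals) is locally integrable and satisfies $(*)$ for every ball $B$, with the same constant $C$. -/

import Mathlib

open MeasureTheory
open scoped ENNReal NNReal

/-- The space `ℝⁿ` with its Euclidean norm and Lebesgue measure. -/
abbrev RSpace (n : ℕ) : Type := EuclideanSpace ℝ (Fin n)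

/-- A weight: an (almost everywhere) positive, locally integrable function. -/
def IsWeight {n : ℕ} (w : RSpace n → ℝ) : Prop :=
  LocallyIntegrable w volume ∧ ∀ᵐ x, 0 < w x

/-- Size condition `|K(x, y)| ≲ (∑ᵢ |x - yᵢ|) ^ (-(mn - α))`, off the diagonal. -/
def KernelSize {m n : ℕ} (α : ℝ) (K : RSpace n → (Fin m → RSpace n) → ℝ) : Prop :=
  ∃ A : ℝ, ∀ (x : RSpace n) (y : Fin m → RSpace n), 0 < ∑ i, ‖x - y i‖ →
    |K x y| ≤ A / (∑ i, ‖x - y i‖) ^ ((m : ℝ) * n - α)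

/-- Smoothness condition of order `γ`:
`|K(x, y) - K(x', y)| ≲ |x - x'| ^ γ (∑ᵢ |x - yᵢ|) ^ (-(mn - α + γ))`
whenever `∑ᵢ |x - yᵢ| > 2 |x - x'|`. -/
def KernelSmooth {m n : ℕ} (α γ : ℝ) (K : RSpace n → (Fin m → RSpace n) → ℝ) : Prop :=
  ∃ A : ℝ, ∀ (x x' : RSpace n) (y : Fin m → RSpace n), 2 * ‖x - x'‖ < ∑ i, ‖x - y i‖ →
    |K x y - K x' y| ≤ A * ‖x - x'‖ ^ γ / (∑ i, ‖x - y i‖) ^ ((m : ℝ) * n - α + γ)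

/-- The Lipschitz space `Λ(δ)`. -/
def MemLipschitz {n : ℕ} (δ : ℝ) (b : RSpace n → ℝ) : Prop :=
  ∃ A : ℝ, ∀ x y : RSpace n, |b x - b y| ≤ A * ‖x - y‖ ^ δ

/-- The multilinear operator `T f(x) = ∫ K(x, y) ∏ᵢ fᵢ(yᵢ) dy` with kernel `K`. -/
noncomputable def kernelOp {m n : ℕ} (K : RSpace n → (Fin m → RSpace n) → ℝ)
    (f : Fin m → RSpace n → ℝ) (x : RSpace n) : ℝ :=
  ∫ y : Fin m → RSpace n, K x y * ∏ i, f i (y i)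

/-- `T f` is defined: for almost every `x` the integral defining `T f(x)` converges absolutely. -/
def KernelOpDefined {m n : ℕ} (K : RSpace n → (Fin m → RSpace n) → ℝ)
    (f : Fin m → RSpace n → ℝ) : Prop :=
  ∀ᵐ x : RSpace n, Integrable (fun y : Fin m → RSpace n => K x y * ∏ i, f i (y i)) volume

/-- The commutator in the `j`-th entry:
`[b, S]_j f = b · S f - S (f₁, …, b fⱼ, …, f_m)`. -/
def entryCommutator {m n : ℕ} (b : RSpace n → ℝ)
    (S : (Fin m → RSpace n → ℝ) → RSpace n → ℝ) (j : Fin m) :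
    (Fin m → RSpace n → ℝ) → RSpace n → ℝ :=
  fun f x => b x * S f x - S (Function.update f j (fun y => b y * f j y)) x

/-- The product commutator `[b_m, … [b₂, [b₁, T]₁]₂ …]_m` of the operator with kernel `K`. -/
noncomputable def productCommutator {m n : ℕ} (K : RSpace n → (Fin m → RSpace n) → ℝ)
    (b : Fin m → RSpace n → ℝ) : (Fin m → RSpace n → ℝ) → RSpace n → ℝ :=
  (List.finRange m).foldl (fun S j => entryCommutator (b j) S j) (kernelOp K)

/-- The product commutator of `f` is defined: so is every one of the `2 ^ m` terms
`T (g₁, …, g_m)`, `gᵢ ∈ {fᵢ, bᵢ fᵢ}`, that occur in it. -/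
def ProductCommutatorDefined {m n : ℕ} (K : RSpace n → (Fin m → RSpace n) → ℝ)
    (b f : Fin m → RSpace n → ℝ) : Prop :=
  ∀ s : Finset (Fin m),
    KernelOpDefined K (fun i y => if i ∈ s then b i y * f i y else f i y)

/-- The integrand of the integral representation of the product commutator,
`K(x, y) ∏ᵢ (bᵢ(x) - bᵢ(yᵢ)) fᵢ(yᵢ)`. -/
def productCommutatorIntegrand {m n : ℕ} (K : RSpace n → (Fin m → RSpace n) → ℝ)
    (b f : Fin m → RSpace n → ℝ) (x : RSpace n) (y : Fin m → RSpace n) : ℝ :=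
  K x y * ∏ i, (b i x - b i (y i)) * f i (y i)

/-- `‖w χ_B‖_∞`. -/
noncomputable def supNormOn {n : ℕ} (w : RSpace n → ℝ) (B : Set (RSpace n)) : ℝ≥0∞ :=
  eLpNorm (B.indicator w) ∞ volume

/-- `g` is locally integrable and, for every ball `B`,
`‖w χ_B‖_∞ |B| ^ (-(1 + τ / n)) ∫_B |g - g_B| ≤ M`;
that is, `g ∈ 𝕃_w(τ)` with seminorm at most `M`. -/
def WeightedLipschitzBound {n : ℕ} (w : RSpace n → ℝ) (τ : ℝ) (g : RSpace n → ℝ)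
    (M : ℝ≥0∞) : Prop :=
  LocallyIntegrable g volume ∧
    ∀ (c : RSpace n) (r : ℝ), 0 < r →
      supNormOn w (Metric.ball c r) / volume (Metric.ball c r) ^ (1 + τ / n) *
        ∫⁻ x in Metric.ball c r, ‖g x - ⨍ z in Metric.ball c r, g z‖ₑ ≤ M

/-- The class `ℍ_m(p, β, τ)` relative to the fixed parameter `δ`. The `i`-th factor is the
`L^{pᵢ'}` norm of `vᵢ⁻¹ (|B|^{1/n} + |x_B - ·|) ^ (-(n - βᵢ + δ/m))`, with `pᵢ'` the conjugate
exponent (`∞` if `pᵢ = 1`, and `1` if `pᵢ = ∞`). -/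
def MemHClass {m n : ℕ} (δ : ℝ) (p : Fin m → ℝ≥0∞) (β τ : ℝ)
    (w : RSpace n → ℝ) (v : Fin m → RSpace n → ℝ) : Prop :=
  ∃ βs : Fin m → ℝ, (∀ i, 0 < βs i ∧ βs i < n) ∧ ∑ i, βs i = β ∧
    ∃ A : ℝ≥0, ∀ (c : RSpace n) (r : ℝ), 0 < r →
      supNormOn w (Metric.ball c r) / volume (Metric.ball c r) ^ ((τ - δ) / n) *
        ∏ i, eLpNorm
          (fun y => (v i y)⁻¹ /
            (volume.real (Metric.ball c r) ^ ((1 : ℝ) / n) + ‖c - y‖) ^ (n - βs i + δ / m))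
          (ENNReal.conjExponent (p i)) volume ≤ A

/-- The reverse Hölder inequality of order `s`,
`(|B|⁻¹ ∫_B u ^ s) ^ (1/s) ≤ A |B|⁻¹ ∫_B u` for every ball `B` (trivially true for `s = 1`). -/
def ReverseHolder {n : ℕ} (s : ℝ) (u : RSpace n → ℝ) : Prop :=
  ∃ A : ℝ≥0, ∀ (c : RSpace n) (r : ℝ), 0 < r →
    (⨍⁻ x in Metric.ball c r, ENNReal.ofReal (u x) ^ s ∂volume) ^ (1 / s) ≤
      A * ⨍⁻ x in Metric.ball c r, ENNReal.ofReal (u x) ∂volume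

/-! Fix a ball B of radius r and center c, write S = ∑ |x - y_i| and α̃ = α + mδ, and cut the
y-space into (6B)^m and its complement. The oscillation of the commutator on B is controlled by the
integral of |F(x, y)| over the first piece, averaged over x in B, and by that of |F(x, y) - F(x',
y)| over the second, for x, x' in B.

Far piece: here S > 5r, so smoothness of K and the Lipschitz bounds on the b_i give |x - x'|^δ
S^(-(mn - α̃ + δ)) ∏ |f_i|. The exponents e_i = n - α̃_i + δ/m of the class ℍ_m add up to exactly
this power, and S dominates |B|^(1/n) + |c - y_i| for every i. The bound therefore factors over i,
and Hölder in each variable produces the norms of ℍ_m (`exists_lintegral_far_le`).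

Local piece: the m Lipschitz factors improve the size bound to S^(-(mn - α̃)). This is at most a
product of Riesz kernels |x - y_i|^(-s_i), and Hölder in x with m factors leaves an L^m bound on B
for one linear fractional integral at a time. Raising to the power m would cost too much
integrability of v_i^(-1); the reverse Hölder condition of order m pays for it
(`exists_lintegral_fractional_pow_le`). Admissible s_i exist because p > n/α̃
(`exists_exponent_splitting`). On 6B the tail weight is comparable to a power of r, so the same ℍ_m
norms appear (`exists_lintegral_local_le`).

Both pieces have size r^δ times the ℍ_m product, and the ℍ_m condition turns this into the claimed
bound. `ae_integrable_sub_and_oscillation_le` works with differences F(x, ·) - F(z, ·) throughout,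
so it yields the statement modulo constants; when the commutator itself converges, it differs from
that function by a constant. -/

/-! ### Tonelli and Jensen inequalities -/

/-- Tonelli's theorem for a product of functions of separate variables. -/
theorem lintegral_fin_prod_eq_prod {m : ℕ} {X : Type*} [MeasurableSpace X] {μ : Measure X}
    [SigmaFinite μ] {f : Fin m → X → ℝ≥0∞} (hf : ∀ i, AEMeasurable (f i) μ) :
    ∫⁻ y : Fin m → X, ∏ i, f i (y i) ∂(Measure.pi fun _ => μ) = ∏ i, ∫⁻ x, f i x ∂μ := by
  induction m with
  | zero => simp
  | succ m ih =>
    have hprod : AEMeasurable (fun y : Fin m → X => ∏ i : Fin m, f i.succ (y i))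
        (Measure.pi fun _ => μ) :=
      Finset.aemeasurable_fun_prod _ fun i _ =>
        (hf i.succ).comp_quasiMeasurePreserving (Measure.quasiMeasurePreserving_eval _ i)
    calc
      _ = ∫⁻ x : X × (Fin m → X), f 0 x.1 * ∏ i : Fin m, f i.succ (x.2 i)
            ∂(μ.prod (Measure.pi fun _ => μ)) := by
          rw [((measurePreserving_piFinSuccAbove (fun _ : Fin (m + 1) => μ) 0).symm).lintegral_map_equiv]
          simp_rw [MeasurableEquiv.piFinSuccAbove_symm_apply, Fin.insertNthEquiv,
            Fin.prod_univ_succ, Fin.insertNth_zero, Equiv.coe_fn_mk, Fin.cons_succ,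
            Fin.cons_zero]
          rfl
      _ = (∫⁻ x, f 0 x ∂μ) * ∏ i : Fin m, ∫⁻ x, f i.succ x ∂μ := by
          rw [← ih fun i => hf i.succ, lintegral_prod_mul (hf 0) hprod]
      _ = _ := by rw [Fin.prod_univ_succ]

/-- Jensen's inequality for the measure G dμ, obtained from Hölder with weights 1/m and 1 - 1/m
applied to F^m G and G. -/
theorem lintegral_mul_pow_le {X : Type*} [MeasurableSpace X] {μ : Measure X} {m : ℕ} (hm : 0 < m)
    {F G : X → ℝ≥0∞} (hF : AEMeasurable F μ) (hG : AEMeasurable G μ) :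
    (∫⁻ x, F x * G x ∂μ) ^ m ≤ (∫⁻ x, F x ^ m * G x ∂μ) * (∫⁻ x, G x ∂μ) ^ (m - 1) := by
  have hm' : (0 : ℝ) < m := by exact_mod_cast hm
  have h1 : (0 : ℝ) ≤ 1 / m := by positivity
  have h2 : (0 : ℝ) ≤ 1 - 1 / m := by
    rw [sub_nonneg, div_le_one hm']; exact_mod_cast hm
  have key := ENNReal.lintegral_mul_norm_pow_le (μ := μ) ((hF.pow_const m).mul hG) hG h1 h2
    (by ring)
  have e : ∀ x, (F x ^ m * G x) ^ (1 / m : ℝ) * G x ^ (1 - 1 / m : ℝ) = F x * G x := by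
    intro x
    rw [ENNReal.mul_rpow_of_nonneg _ _ h1, mul_assoc, ← ENNReal.rpow_add_of_nonneg _ _ h1 h2,
      ← ENNReal.rpow_natCast, ← ENNReal.rpow_mul]
    simp [hm'.ne']
  simp only [Pi.mul_apply, e] at key
  calc _ ≤ _ := pow_le_pow_left' key m
    _ = _ := by
      rw [mul_pow, ← ENNReal.rpow_natCast, ← ENNReal.rpow_natCast, ← ENNReal.rpow_mul,
        ← ENNReal.rpow_mul]
      have : (1 - 1 / (m : ℝ)) * m = ((m - 1 : ℕ) : ℝ) := by
        rw [Nat.cast_sub hm]; field_simp; simp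
      rw [this, ENNReal.rpow_natCast]
      simp [hm'.ne']

/-! ### Scaling of balls and of Riesz kernels -/

theorem ofReal_rpow_add {R : ℝ} (hR : 0 < R) (a b : ℝ) :
    ENNReal.ofReal R ^ (a + b) = ENNReal.ofReal R ^ a * ENNReal.ofReal R ^ b :=
  ENNReal.rpow_add _ _ (by simpa using hR) ENNReal.ofReal_ne_top

theorem ofReal_rpow_ne_top {R : ℝ} (hR : 0 < R) (a : ℝ) : ENNReal.ofReal R ^ a ≠ ∞ := by
  simp [ENNReal.rpow_eq_top_iff, hR.not_ge]

theorem volume_ball_eq {n : ℕ} (c : RSpace n) {R : ℝ} (hR : 0 < R) :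
    volume (Metric.ball c R) =
      ENNReal.ofReal R ^ (n : ℝ) * volume (Metric.ball (0 : RSpace n) 1) := by
  rw [Measure.addHaar_ball_of_pos _ _ hR, finrank_euclideanSpace_fin, ENNReal.ofReal_pow hR.le,
    ENNReal.rpow_natCast]

theorem lintegral_unit_ball_enorm_rpow_lt_top {n : ℕ} (hn : 0 < n) {s : ℝ} (hs : s < n) :
    ∫⁻ y in Metric.ball (0 : RSpace n) 1, ‖y‖ₑ ^ (-s) < ∞ := by
  have : Nonempty (Fin n) := ⟨⟨0, hn⟩⟩
  have hint : IntegrableOn (fun y : RSpace n => ‖y‖ ^ (-s)) (Metric.ball 0 1) := by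
    rw [integrableOn_fun_norm_addHaar volume (f := fun t : ℝ => t ^ (-s)),
      finrank_euclideanSpace_fin]
    have h : IntegrableOn (fun t : ℝ => t ^ ((n : ℝ) - 1 - s)) (Set.Ioo 0 1) :=
      (intervalIntegral.integrableOn_Ioo_rpow_iff one_pos).2 (by linarith)
    refine h.congr_fun (fun t ht => ?_) measurableSet_Ioo
    have h1 : ((n - 1 : ℕ) : ℝ) = (n : ℝ) - 1 := by rw [Nat.cast_sub hn]; simp
    simp only [smul_eq_mul]
    rw [← Real.rpow_natCast, h1, ← Real.rpow_add ht.1]; ring_nf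
  have h := hint.2
  rw [hasFiniteIntegral_iff_enorm] at h
  refine lt_of_le_of_lt (lintegral_mono_ae ?_) h
  refine ae_restrict_of_ae ?_
  filter_upwards [Measure.ae_ne volume (0 : RSpace n)] with y hy
  rw [← ofReal_norm, ← ofReal_norm, ENNReal.ofReal_rpow_of_pos (norm_pos_iff.2 hy),
    Real.norm_of_nonneg (by positivity)]

theorem lintegral_ball_enorm_rpow {n : ℕ} {s : ℝ} {R : ℝ} (hR : 0 < R) :
    ∫⁻ y in Metric.ball (0 : RSpace n) R, ‖y‖ₑ ^ (-s) =
      ENNReal.ofReal R ^ ((n : ℝ) - s) *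
        ∫⁻ y in Metric.ball (0 : RSpace n) 1, ‖y‖ₑ ^ (-s) := by
  have hmap := Measure.map_addHaar_smul (volume : Measure (RSpace n)) hR.ne'
  have hmeas : Measurable fun y : RSpace n => (Metric.ball (0 : RSpace n) R).indicator
      (fun y => ‖y‖ₑ ^ (-s)) y :=
    Measurable.indicator (by fun_prop) measurableSet_ball
  have h1 := lintegral_map (μ := volume) hmeas (measurable_const_smul R)
  rw [hmap, lintegral_smul_measure, lintegral_indicator measurableSet_ball] at h1
  have h2 : ∀ y : RSpace n, (Metric.ball (0 : RSpace n) R).indicator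
      (fun y => ‖y‖ₑ ^ (-s)) (R • y) = ENNReal.ofReal R ^ (-s) *
        (Metric.ball (0 : RSpace n) 1).indicator (fun y => ‖y‖ₑ ^ (-s)) y := by
    intro y
    have hmem : R • y ∈ Metric.ball (0 : RSpace n) R ↔ y ∈ Metric.ball (0 : RSpace n) 1 := by
      simp [norm_smul, abs_of_pos hR, hR]
    by_cases hy : y ∈ Metric.ball (0 : RSpace n) 1
    · rw [Set.indicator_of_mem (hmem.2 hy), Set.indicator_of_mem hy, enorm_smul,
        Real.enorm_of_nonneg hR.le, ENNReal.mul_rpow_of_ne_top (by simp) (by simp)]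
    · rw [Set.indicator_of_notMem (hmem.not.2 hy), Set.indicator_of_notMem hy, mul_zero]
  simp only [h2] at h1
  rw [lintegral_const_mul' _ _ (ofReal_rpow_ne_top hR _), lintegral_indicator measurableSet_ball,
    finrank_euclideanSpace_fin, abs_of_pos (by positivity), ENNReal.ofReal_inv_of_pos (by positivity),
    ENNReal.ofReal_pow hR.le, ← ENNReal.rpow_natCast, ← ENNReal.rpow_neg, smul_eq_mul] at h1
  rw [sub_eq_add_neg, ofReal_rpow_add hR, mul_assoc, ← h1, ← mul_assoc, ← ofReal_rpow_add hR]
  simp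

/-- The integral of `|x - y| ^ (-s)`, `s < n`, over a ball about a point near `x`. -/
theorem exists_lintegral_ball_enorm_sub_rpow_le {n : ℕ} (hn : 0 < n) {s : ℝ} (hs : s < n) :
    ∃ C : ℝ≥0, ∀ (c x : RSpace n) (R : ℝ), 0 < R → x ∈ Metric.ball c R →
      ∫⁻ y in Metric.ball c R, ‖x - y‖ₑ ^ (-s) ≤ C * ENNReal.ofReal R ^ ((n : ℝ) - s) := by
  have hfin := (lintegral_unit_ball_enorm_rpow_lt_top hn hs).ne
  set I := ∫⁻ y in Metric.ball (0 : RSpace n) 1, ‖y‖ₑ ^ (-s)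
  refine ⟨(ENNReal.ofReal 2 ^ ((n : ℝ) - s) * I).toNNReal, fun c x R hR hx => ?_⟩
  rw [ENNReal.coe_toNNReal (ENNReal.mul_ne_top (ofReal_rpow_ne_top two_pos _) hfin)]
  calc ∫⁻ y in Metric.ball c R, ‖x - y‖ₑ ^ (-s)
      ≤ ∫⁻ y in Metric.ball x (2 * R), ‖x - y‖ₑ ^ (-s) := by
        refine lintegral_mono_set fun y hy => ?_
        rw [Metric.mem_ball] at *
        have := dist_triangle_right y x c
        linarith
    _ = ∫⁻ y in Metric.ball (0 : RSpace n) (2 * R), ‖y‖ₑ ^ (-s) := by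
        rw [← lintegral_indicator measurableSet_ball, ← lintegral_indicator measurableSet_ball,
          ← lintegral_sub_left_eq_self _ x]
        congr with y
        simp [Set.indicator, dist_eq_norm]
    _ = _ := by
        rw [lintegral_ball_enorm_rpow (by positivity), ENNReal.ofReal_mul two_pos.le,
          ENNReal.mul_rpow_of_ne_top (by simp) (by simp)]
        ring

theorem aemeasurable_mul_enorm_sub_rpow {n : ℕ} {μ ν : Measure (RSpace n)} [SFinite μ] [SFinite ν]
    {H : RSpace n → ℝ≥0∞} (hH : AEMeasurable H ν) (s : ℝ) :
    AEMeasurable (fun z : RSpace n × RSpace n => H z.2 * ‖z.1 - z.2‖ₑ ^ s) (μ.prod ν) :=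
  (hH.comp_snd).mul (by fun_prop)

/-! ### L^m bounds on a ball for linear fractional integrals -/

/-- Jensen with respect to H dy moves the power m onto the kernel, and Tonelli then integrates |x -
y|^(-sm) in x. This is where s m < n is needed; H is only used in L^1. -/
theorem exists_lintegral_riesz_pow_le_of_L1 {n m : ℕ} (hn : 0 < n) (hm : 0 < m) {s : ℝ}
    (hs : s * m < n) :
    ∃ C : ℝ≥0, ∀ (c : RSpace n) (R : ℝ), 0 < R → ∀ H : RSpace n → ℝ≥0∞, AEMeasurable H volume →
      ∫⁻ x in Metric.ball c R, (∫⁻ y in Metric.ball c R, H y * ‖x - y‖ₑ ^ (-s)) ^ m ≤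
        C * ENNReal.ofReal R ^ ((n : ℝ) - s * m) * (∫⁻ y in Metric.ball c R, H y) ^ m := by
  obtain ⟨C, hC⟩ := exists_lintegral_ball_enorm_sub_rpow_le hn hs
  refine ⟨C, fun c R hR H hH => ?_⟩
  set ν := volume.restrict (Metric.ball c R)
  have hHν : AEMeasurable H ν := hH.restrict
  calc ∫⁻ x, (∫⁻ y, H y * ‖x - y‖ₑ ^ (-s) ∂ν) ^ m ∂ν
      ≤ ∫⁻ x, (∫⁻ y, H y * ‖x - y‖ₑ ^ (-(s * m)) ∂ν) * (∫⁻ y, H y ∂ν) ^ (m - 1) ∂ν := by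
        refine lintegral_mono fun x => ?_
        have h := lintegral_mul_pow_le (μ := ν) hm (F := fun y => ‖x - y‖ₑ ^ (-s)) (G := H)
          (by fun_prop) hHν
        refine (le_of_eq ?_).trans (h.trans (le_of_eq ?_))
        · simp only [mul_comm]
        · simp only [← ENNReal.rpow_natCast, ← ENNReal.rpow_mul, mul_comm (H _), neg_mul]
    _ = (∫⁻ x, ∫⁻ y, H y * ‖x - y‖ₑ ^ (-(s * m)) ∂ν ∂ν) * (∫⁻ y, H y ∂ν) ^ (m - 1) :=
        lintegral_mul_const'' _
          (AEMeasurable.lintegral_prod_right' (aemeasurable_mul_enorm_sub_rpow hHν _))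
    _ = (∫⁻ y, ∫⁻ x, H y * ‖x - y‖ₑ ^ (-(s * m)) ∂ν ∂ν) * (∫⁻ y, H y ∂ν) ^ (m - 1) := by
        rw [lintegral_lintegral_swap (aemeasurable_mul_enorm_sub_rpow hHν _)]
    _ ≤ (∫⁻ y, H y * (C * ENNReal.ofReal R ^ ((n : ℝ) - s * m)) ∂ν) *
          (∫⁻ y, H y ∂ν) ^ (m - 1) := by
        refine mul_le_mul' (setLIntegral_mono' measurableSet_ball fun y hy => ?_) le_rfl
        rw [lintegral_const_mul _ (by fun_prop)]
        gcongr
        simp_rw [← neg_sub y, enorm_neg]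
        exact hC c y R hR hy
    _ = _ := by
        rw [lintegral_mul_const'' _ hHν, mul_comm (lintegral _ _), mul_assoc, mul_pow_sub_one hm.ne']

/-- Jensen with respect to |x - y|^(-s) dy, whose mass on the ball is at most D, moves the power
onto U instead. The kernel is never raised to a power, so s < n suffices, at the price of U in L^m.
-/
theorem exists_lintegral_riesz_pow_le_of_Lm {n m : ℕ} (hn : 0 < n) (hm : 0 < m) {s : ℝ}
    (hs : s < n) :
    ∃ C : ℝ≥0, ∀ (c : RSpace n) (R : ℝ), 0 < R → ∀ U : RSpace n → ℝ≥0∞, AEMeasurable U volume →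
      ∫⁻ x in Metric.ball c R, (∫⁻ y in Metric.ball c R, U y * ‖x - y‖ₑ ^ (-s)) ^ m ≤
        C * ENNReal.ofReal R ^ (((n : ℝ) - s) * m) * ∫⁻ y in Metric.ball c R, U y ^ m := by
  obtain ⟨C, hC⟩ := exists_lintegral_ball_enorm_sub_rpow_le hn hs
  refine ⟨C ^ m, fun c R hR U hU => ?_⟩
  set ν := volume.restrict (Metric.ball c R)
  have hUν : AEMeasurable (fun y => U y ^ m) ν := hU.restrict.pow_const m
  set D : ℝ≥0∞ := C * ENNReal.ofReal R ^ ((n : ℝ) - s) with hD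
  calc ∫⁻ x, (∫⁻ y, U y * ‖x - y‖ₑ ^ (-s) ∂ν) ^ m ∂ν
      ≤ ∫⁻ x, (∫⁻ y, U y ^ m * ‖x - y‖ₑ ^ (-s) ∂ν) * D ^ (m - 1) ∂ν := by
        refine setLIntegral_mono' measurableSet_ball fun x hx => ?_
        refine (lintegral_mul_pow_le hm hU.restrict (by fun_prop)).trans ?_
        gcongr
        exact hC c x R hR hx
    _ = (∫⁻ x, ∫⁻ y, U y ^ m * ‖x - y‖ₑ ^ (-s) ∂ν ∂ν) * D ^ (m - 1) :=
        lintegral_mul_const'' _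
          (AEMeasurable.lintegral_prod_right' (aemeasurable_mul_enorm_sub_rpow hUν _))
    _ = (∫⁻ y, ∫⁻ x, U y ^ m * ‖x - y‖ₑ ^ (-s) ∂ν ∂ν) * D ^ (m - 1) := by
        rw [lintegral_lintegral_swap (aemeasurable_mul_enorm_sub_rpow hUν _)]
    _ ≤ (∫⁻ y, U y ^ m * D ∂ν) * D ^ (m - 1) := by
        refine mul_le_mul' (setLIntegral_mono' measurableSet_ball fun y hy => ?_) le_rfl
        rw [lintegral_const_mul _ (by fun_prop)]
        gcongr
        simp_rw [← neg_sub y, enorm_neg]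
        exact hC c y R hR hy
    _ = D ^ m * ∫⁻ y, U y ^ m ∂ν := by
        rw [lintegral_mul_const'' _ hUν, mul_assoc, mul_pow_sub_one hm.ne', mul_comm]
    _ = _ := by
        rw [hD, mul_pow, ← ENNReal.rpow_natCast (ENNReal.ofReal R ^ _), ← ENNReal.rpow_mul]
        simp

/-- The sign conditions cover z = 0, the diagonal of the kernel, where all three powers are ∞. -/
theorem rpow_neg_add_of_pos {z : ℝ≥0∞} (hz : z ≠ ∞) {a b : ℝ} (ha : 0 < a) (hb : 0 < b) :
    z ^ (-(a + b)) = z ^ (-a) * z ^ (-b) := by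
  rcases eq_or_ne z 0 with rfl | h0
  · rw [ENNReal.zero_rpow_of_neg (by linarith), ENNReal.zero_rpow_of_neg (by linarith),
      ENNReal.zero_rpow_of_neg (by linarith)]
    rfl
  · rw [neg_add, ENNReal.rpow_add _ _ h0 hz]

/-- Write s = a + b and apply Hölder in y, giving |x - y|^(-a) to h and |x - y|^(-b) to u; then
apply Hölder in x with the same exponents. The factor with h^P is bounded by the L^1 estimate, which
needs a P m < n. The factor with u^P' is bounded by the L^m estimate, which needs only b P' < n; the
resulting integral of (u^P')^m is absorbed by the reverse Hölder hypothesis. The bound on s is what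
makes such a and b available. -/
theorem exists_lintegral_riesz_pow_le_of_one_lt {n m : ℕ} (hn : 0 < n) (hm : 0 < m) {P P' s : ℝ}
    (hP : P.HolderConjugate P') (hs0 : 0 < s) (hs : s < n / (P * m) + n / P') (A : ℝ≥0) :
    ∃ C : ℝ≥0, ∀ (c : RSpace n) (R : ℝ), 0 < R → ∀ h u : RSpace n → ℝ≥0∞,
      AEMeasurable h volume → AEMeasurable u volume →
      ∫⁻ y in Metric.ball c R, (u y ^ P') ^ m ≤
        A * ENNReal.ofReal R ^ ((n : ℝ) * (1 - m)) * (∫⁻ y in Metric.ball c R, u y ^ P') ^ m →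
      ∫⁻ x in Metric.ball c R, (∫⁻ y in Metric.ball c R, h y * u y * ‖x - y‖ₑ ^ (-s)) ^ m ≤
        C * (ENNReal.ofReal R ^ ((n : ℝ) / m - s) *
          (∫⁻ y in Metric.ball c R, h y ^ P) ^ (1 / P) *
          (∫⁻ y in Metric.ball c R, u y ^ P') ^ (1 / P')) ^ m := by
  have hm' : (0 : ℝ) < m := by exact_mod_cast hm
  have hn' : (0 : ℝ) < n := by exact_mod_cast hn
  have hPpos : 0 < P := hP.pos
  have hP'pos : 0 < P' := hP.symm.pos
  -- Divide s in proportion to the two thresholds, whose sum exceeds s.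
  obtain ⟨a, b, ha, hb, hab, haA, hbB⟩ : ∃ a b : ℝ, 0 < a ∧ 0 < b ∧ a + b = s ∧
      a < n / (P * m) ∧ b < n / P' := by
    set S : ℝ := n / (P * m)
    set T : ℝ := n / P'
    have hS : 0 < S := by positivity
    have hT : 0 < T := by positivity
    refine ⟨s * (S / (S + T)), s * (T / (S + T)), by positivity, by positivity, by field_simp,
      ?_, ?_⟩
    · rw [← mul_div_assoc, div_lt_iff₀ (by positivity)]; nlinarith
    · rw [← mul_div_assoc, div_lt_iff₀ (by positivity)]; nlinarith
  have haP : a * P * m < n := by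
    rw [lt_div_iff₀ (by positivity)] at haA; linarith
  have hbP : b * P' < n := by rwa [lt_div_iff₀ hP'pos] at hbB
  obtain ⟨C₁, hC₁⟩ := exists_lintegral_riesz_pow_le_of_L1 hn hm haP
  obtain ⟨C₂, hC₂⟩ := exists_lintegral_riesz_pow_le_of_Lm hn hm hbP
  refine ⟨C₁ ^ (1 / P) * (C₂ * A) ^ (1 / P'), fun c R hR h u hh hu hRH => ?_⟩
  have hhP : AEMeasurable (fun y => h y ^ P) volume := hh.pow_const P
  have huP : AEMeasurable (fun y => u y ^ P') volume := hu.pow_const P'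
  have h1 := hC₁ c R hR _ hhP
  have h2 := hC₂ c R hR _ huP
  set ν := volume.restrict (Metric.ball c R)
  set X : RSpace n → ℝ≥0∞ := fun x => ∫⁻ y, h y ^ P * ‖x - y‖ₑ ^ (-(a * P)) ∂ν with hX
  set Y : RSpace n → ℝ≥0∞ := fun x => ∫⁻ y, u y ^ P' * ‖x - y‖ₑ ^ (-(b * P')) ∂ν with hY
  have hXm : AEMeasurable X ν :=
    AEMeasurable.lintegral_prod_right' (aemeasurable_mul_enorm_sub_rpow hhP.restrict _)
  have hYm : AEMeasurable Y ν :=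
    AEMeasurable.lintegral_prod_right' (aemeasurable_mul_enorm_sub_rpow huP.restrict _)
  have hJ : ∀ x, ∫⁻ y, h y * u y * ‖x - y‖ₑ ^ (-s) ∂ν ≤ X x ^ (1 / P) * Y x ^ (1 / P') := by
    intro x
    have hol := ENNReal.lintegral_mul_le_Lp_mul_Lq ν hP
      (f := fun y => h y * ‖x - y‖ₑ ^ (-a)) (g := fun y => u y * ‖x - y‖ₑ ^ (-b))
      (hh.restrict.mul (by fun_prop)) (hu.restrict.mul (by fun_prop))
    refine (le_of_eq ?_).trans (hol.trans (le_of_eq ?_))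
    · refine lintegral_congr fun y => ?_
      rw [← hab, rpow_neg_add_of_pos (by simp) ha hb]
      simp only [Pi.mul_apply]; ring
    · simp only [hX, hY, ENNReal.mul_rpow_of_nonneg _ _ hPpos.le,
        ENNReal.mul_rpow_of_nonneg _ _ hP'pos.le, ← ENNReal.rpow_mul, neg_mul]
  have hsum : 1 / P + 1 / P' = 1 := by simpa using hP.inv_add_inv_eq_one
  have e1 : 0 ≤ 1 / P := by positivity
  have e2 : 0 ≤ 1 / P' := by positivity
  set N₁ := ∫⁻ y, h y ^ P ∂ν
  set N₂ := ∫⁻ y, u y ^ P' ∂ν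
  have expo : ((n : ℝ) - a * P * m) * (1 / P) +
      (((n : ℝ) - b * P') * m + n * (1 - m)) * (1 / P') = ((n : ℝ) / m - s) * m := by
    have h3 : (n : ℝ) / m * m = n := by field_simp
    have h4 : P * (1 / P) = 1 := by field_simp
    have h5 : P' * (1 / P') = 1 := by field_simp
    rw [← hab, sub_mul ((n : ℝ) / m), h3]
    linear_combination (n : ℝ) * hsum - a * m * h4 - b * m * h5
  calc ∫⁻ x, (∫⁻ y, h y * u y * ‖x - y‖ₑ ^ (-s) ∂ν) ^ m ∂ν
      ≤ ∫⁻ x, (X x ^ m) ^ (1 / P) * (Y x ^ m) ^ (1 / P') ∂ν := by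
        refine lintegral_mono fun x => (pow_le_pow_left' (hJ x) m).trans (le_of_eq ?_)
        simp only [mul_pow, ← ENNReal.rpow_natCast, ← ENNReal.rpow_mul]
        rw [mul_comm (1 / P), mul_comm (1 / P')]
    _ ≤ (∫⁻ x, X x ^ m ∂ν) ^ (1 / P) * (∫⁻ x, Y x ^ m ∂ν) ^ (1 / P') :=
        ENNReal.lintegral_mul_norm_pow_le (hXm.pow_const m) (hYm.pow_const m) e1 e2 hsum
    _ ≤ (C₁ * ENNReal.ofReal R ^ ((n : ℝ) - a * P * m) * N₁ ^ m) ^ (1 / P) *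
          (C₂ * ENNReal.ofReal R ^ (((n : ℝ) - b * P') * m) *
            (A * ENNReal.ofReal R ^ ((n : ℝ) * (1 - m)) * N₂ ^ m)) ^ (1 / P') := by
        refine mul_le_mul' (ENNReal.rpow_le_rpow h1 e1) (ENNReal.rpow_le_rpow (h2.trans ?_) e2)
        exact mul_le_mul' le_rfl hRH
    _ = _ := by
        have r1 : (C₂ * ENNReal.ofReal R ^ (((n : ℝ) - b * P') * m) *
            (A * ENNReal.ofReal R ^ ((n : ℝ) * (1 - m)) * N₂ ^ m)) =
            (C₂ * A) * ENNReal.ofReal R ^ (((n : ℝ) - b * P') * m + n * (1 - m)) * N₂ ^ m := by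
          rw [ofReal_rpow_add hR]; ring
        rw [r1]
        simp only [mul_pow, ENNReal.mul_rpow_of_nonneg _ _ e1, ENNReal.mul_rpow_of_nonneg _ _ e2,
          ← ENNReal.rpow_natCast, ← ENNReal.rpow_mul, ENNReal.coe_mul, NNReal.mul_rpow,
          ← ENNReal.coe_rpow_of_nonneg _ e1, ← ENNReal.coe_rpow_of_nonneg _ e2]
        rw [← expo, ofReal_rpow_add hR, mul_comm (m : ℝ), mul_comm (m : ℝ)]
        ring

/-- `L^m` bound on a ball for the fractional integral of `h u`, `h ∈ L^p`, where `u` has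
`|u|^{p'}` satisfying a reverse Hölder inequality. -/
theorem exists_lintegral_fractional_pow_le {n m : ℕ} (hn : 0 < n) (hm : 0 < m) {p : ℝ≥0∞}
    (hp : 1 ≤ p) {s : ℝ} (hs0 : 0 < s)
    (hs : s < n - (1 - 1 / (m : ℝ)) * (n * (p⁻¹).toReal)) (A : ℝ≥0) :
    ∃ C : ℝ≥0, ∀ (c : RSpace n) (R : ℝ), 0 < R → ∀ h u : RSpace n → ℝ,
      AEStronglyMeasurable h volume → AEStronglyMeasurable u volume →
      (1 < p → ∫⁻ y in Metric.ball c R, (‖u y‖ₑ ^ (ENNReal.conjExponent p).toReal) ^ m ≤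
        A * ENNReal.ofReal R ^ ((n : ℝ) * (1 - m)) *
          (∫⁻ y in Metric.ball c R, ‖u y‖ₑ ^ (ENNReal.conjExponent p).toReal) ^ m) →
      ∫⁻ x in Metric.ball c R, (∫⁻ y in Metric.ball c R,
          ‖h y‖ₑ * ‖u y‖ₑ * ‖x - y‖ₑ ^ (-s)) ^ m ≤
        C * (ENNReal.ofReal R ^ ((n : ℝ) / m - s) * eLpNorm h p volume *
          eLpNorm u (ENNReal.conjExponent p) (volume.restrict (Metric.ball c R))) ^ m := by
  have hm' : (0 : ℝ) < m := by exact_mod_cast hm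
  have hn' : (0 : ℝ) < n := by exact_mod_cast hn
  have hmono : ∀ (c : RSpace n) (R : ℝ) (h : RSpace n → ℝ),
      eLpNorm h p (volume.restrict (Metric.ball c R)) ≤ eLpNorm h p volume :=
    fun c R h => eLpNorm_mono_measure _ Measure.restrict_le_self
  have hexp : ∀ R : ℝ, (ENNReal.ofReal R ^ ((n : ℝ) / m - s)) ^ m =
      ENNReal.ofReal R ^ ((n : ℝ) - s * m) := by
    intro R
    rw [← ENNReal.rpow_natCast, ← ENNReal.rpow_mul, sub_mul]; congr 2; field_simp
  -- The condition on s reads s < n/m at p = 1, where u is bounded and the L^1 estimate applies to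
  -- h, and s < n at p = ∞, where h is bounded and the L^m estimate applies to u. In between it is
  -- n/(pm) + n/p'.
  rcases hp.eq_or_lt with rfl | hp1
  · have hs' : s * m < n := by
      have : s < n / m := by
        refine hs.trans_eq ?_
        simp; ring
      rwa [lt_div_iff₀ hm'] at this
    obtain ⟨C, hC⟩ := exists_lintegral_riesz_pow_le_of_L1 hn hm hs'
    refine ⟨C, fun c R hR h u hh hu _ => ?_⟩
    have h1 := hC c R hR (fun y => ‖h y‖ₑ) hh.enorm
    have hconj : ENNReal.conjExponent 1 = ∞ := by simp [ENNReal.conjExponent]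
    rw [hconj, eLpNorm_one_eq_lintegral_enorm]
    set ν := volume.restrict (Metric.ball c R)
    set M := eLpNorm u ∞ ν
    have hM : ∀ᵐ y ∂ν, ‖u y‖ₑ ≤ M := by
      simpa [M, eLpNorm_exponent_top] using ae_le_eLpNormEssSup (f := u) (μ := ν)
    calc ∫⁻ x, (∫⁻ y, ‖h y‖ₑ * ‖u y‖ₑ * ‖x - y‖ₑ ^ (-s) ∂ν) ^ m ∂ν
        ≤ ∫⁻ x, ((∫⁻ y, ‖h y‖ₑ * ‖x - y‖ₑ ^ (-s) ∂ν)) ^ m * M ^ m ∂ν := by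
          refine lintegral_mono fun x => ?_
          rw [← mul_pow, ← lintegral_mul_const'' M
            (f := fun y => ‖h y‖ₑ * ‖x - y‖ₑ ^ (-s)) (hh.restrict.enorm.mul (by fun_prop))]
          refine pow_le_pow_left' (lintegral_mono_ae ?_) m
          filter_upwards [hM] with y hy
          calc _ ≤ ‖h y‖ₑ * M * ‖x - y‖ₑ ^ (-s) := by gcongr
            _ = _ := by ring
      _ = (∫⁻ x, ((∫⁻ y, ‖h y‖ₑ * ‖x - y‖ₑ ^ (-s) ∂ν)) ^ m ∂ν) * M ^ m :=
          lintegral_mul_const'' _ ((AEMeasurable.lintegral_prod_right'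
            (aemeasurable_mul_enorm_sub_rpow hh.restrict.enorm _)).pow_const m)
      _ ≤ (C * ENNReal.ofReal R ^ ((n : ℝ) - s * m) * (∫⁻ y, ‖h y‖ₑ ∂ν) ^ m) * M ^ m := by
          gcongr
      _ = C * (ENNReal.ofReal R ^ ((n : ℝ) / m - s) * (∫⁻ y, ‖h y‖ₑ ∂ν) * M) ^ m := by
          rw [mul_pow, mul_pow, hexp]; ring
      _ ≤ _ := by
          gcongr
          exact Measure.restrict_le_self
  rcases eq_or_ne p ∞ with rfl | hptop
  · have hs' : s < n := by simpa using hs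
    obtain ⟨C, hC⟩ := exists_lintegral_riesz_pow_le_of_Lm hn hm hs'
    have hconj : ENNReal.conjExponent ∞ = 1 := by simp [ENNReal.conjExponent]
    rw [hconj]
    refine ⟨C * A, fun c R hR h u hh hu hRH => ?_⟩
    have h1 := hC c R hR (fun y => ‖u y‖ₑ) hu.enorm
    replace hRH := hRH hp1
    simp only [ENNReal.toReal_one, ENNReal.rpow_one] at hRH
    rw [eLpNorm_one_eq_lintegral_enorm]
    refine le_trans ?_ (mul_le_mul' le_rfl (pow_le_pow_left' (mul_le_mul' (mul_le_mul' le_rfl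
      (hmono c R h)) le_rfl) m))
    set ν := volume.restrict (Metric.ball c R)
    set M := eLpNorm h ∞ ν
    have hM : ∀ᵐ y ∂ν, ‖h y‖ₑ ≤ M := by
      simpa [M, eLpNorm_exponent_top] using ae_le_eLpNormEssSup (f := h) (μ := ν)
    calc ∫⁻ x, (∫⁻ y, ‖h y‖ₑ * ‖u y‖ₑ * ‖x - y‖ₑ ^ (-s) ∂ν) ^ m ∂ν
        ≤ ∫⁻ x, ((∫⁻ y, ‖u y‖ₑ * ‖x - y‖ₑ ^ (-s) ∂ν)) ^ m * M ^ m ∂ν := by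
          refine lintegral_mono fun x => ?_
          rw [← mul_pow, ← lintegral_mul_const'' M
            (f := fun y => ‖u y‖ₑ * ‖x - y‖ₑ ^ (-s)) (hu.restrict.enorm.mul (by fun_prop))]
          refine pow_le_pow_left' (lintegral_mono_ae ?_) m
          filter_upwards [hM] with y hy
          calc _ ≤ M * ‖u y‖ₑ * ‖x - y‖ₑ ^ (-s) := by gcongr
            _ = _ := by ring
      _ = (∫⁻ x, ((∫⁻ y, ‖u y‖ₑ * ‖x - y‖ₑ ^ (-s) ∂ν)) ^ m ∂ν) * M ^ m :=
          lintegral_mul_const'' _ ((AEMeasurable.lintegral_prod_right'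
            (aemeasurable_mul_enorm_sub_rpow hu.restrict.enorm _)).pow_const m)
      _ ≤ (C * ENNReal.ofReal R ^ (((n : ℝ) - s) * m) *
            (A * ENNReal.ofReal R ^ ((n : ℝ) * (1 - m)) * (∫⁻ y, ‖u y‖ₑ ∂ν) ^ m)) * M ^ m := by
          exact mul_le_mul' (h1.trans (mul_le_mul' le_rfl hRH)) le_rfl
      _ = _ := by
          have : (n : ℝ) - s * m = (n - s) * m + n * (1 - m) := by ring
          rw [mul_pow, mul_pow, hexp, this, ofReal_rpow_add hR, ENNReal.coe_mul]; ring
  · have hcon : ENNReal.HolderConjugate p (ENNReal.conjExponent p) :=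
      ENNReal.HolderConjugate.conjExponent hp
    have hp'top : ENNReal.conjExponent p ≠ ∞ := by
      simp [ENNReal.conjExponent, tsub_eq_zero_iff_le, hp1]
    have hp'1 : 1 ≤ ENNReal.conjExponent p := by simp [ENNReal.conjExponent]
    have hp0 : p ≠ 0 := (zero_lt_one.trans hp1).ne'
    have hp'0 : ENNReal.conjExponent p ≠ 0 := (zero_lt_one.trans_le hp'1).ne'
    have hPpos : 0 < p.toReal := ENNReal.toReal_pos hp0 hptop
    have hP'pos : 0 < (ENNReal.conjExponent p).toReal := ENNReal.toReal_pos hp'0 hp'top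
    have hinv : p.toReal⁻¹ + (ENNReal.conjExponent p).toReal⁻¹ = 1 := by
      have := congrArg ENNReal.toReal hcon.inv_add_inv_eq_one
      rwa [ENNReal.toReal_add (by simpa using hp0) (by simpa using hp'0), ENNReal.toReal_inv,
        ENNReal.toReal_inv, ENNReal.toReal_one] at this
    have hP : p.toReal.HolderConjugate (ENNReal.conjExponent p).toReal :=
      Real.holderConjugate_iff.2 ⟨by
        rw [← ENNReal.toReal_one]; exact (ENNReal.toReal_lt_toReal (by simp) hptop).2 hp1, hinv⟩
    have hs' : s < n / (p.toReal * m) + n / (ENNReal.conjExponent p).toReal := by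
      refine hs.trans_eq ?_
      rw [ENNReal.toReal_inv, div_eq_mul_inv (n : ℝ) (ENNReal.conjExponent p).toReal,
        eq_sub_of_add_eq' hinv]
      field_simp; ring
    obtain ⟨C, hC⟩ := exists_lintegral_riesz_pow_le_of_one_lt hn hm hP hs0 hs' A
    refine ⟨C, fun c R hR h u hh hu hRH => ?_⟩
    refine (hC c R hR _ _ hh.enorm hu.enorm (hRH hp1)).trans ?_
    rw [← eLpNorm_eq_lintegral_rpow_enorm_toReal hp0 hptop,
      ← eLpNorm_eq_lintegral_rpow_enorm_toReal hp'0 hp'top]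
    gcongr
    exact Measure.restrict_le_self

/-! ### The multilinear fractional integral -/

theorem ENNReal_rpow_neg_sum {ι : Type*} (t : Finset ι) {S : ℝ≥0∞} (h0 : S ≠ 0) (ht : S ≠ ∞)
    (s : ι → ℝ) : S ^ (-∑ i ∈ t, s i) = ∏ i ∈ t, S ^ (-s i) := by
  classical
  induction t using Finset.induction_on with
  | empty => simp
  | insert a t ha ih => rw [Finset.sum_insert ha, Finset.prod_insert ha, ← ih, neg_add,
      ENNReal.rpow_add _ _ h0 ht]

theorem ofReal_rpow_sum {ι : Type*} (t : Finset ι) {R : ℝ} (hR : 0 < R) (s : ι → ℝ) :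
    ENNReal.ofReal R ^ (∑ i ∈ t, s i) = ∏ i ∈ t, ENNReal.ofReal R ^ s i := by
  have h := ENNReal_rpow_neg_sum t (S := ENNReal.ofReal R) (by simpa using hR)
    ENNReal.ofReal_ne_top fun i => -s i
  simpa using h

/-- Each z_i is at most the sum, and negative powers reverse the order. If the sum vanishes, every
factor on the right is ∞. -/
theorem sum_rpow_neg_le_prod {ι : Type*} [Fintype ι] [Nonempty ι] {s : ι → ℝ} (hs : ∀ i, 0 < s i)
    {z : ι → ℝ≥0∞} (hz : ∀ i, z i ≠ ∞) : (∑ i, z i) ^ (-∑ i, s i) ≤ ∏ i, z i ^ (-s i) := by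
  rcases eq_or_ne (∑ i, z i) 0 with h0 | h0
  · have hz0 : ∀ i, z i = 0 := by simpa using h0
    have : ∏ i, z i ^ (-s i) = ∞ := by
      rw [Finset.prod_congr rfl fun i _ => by
        rw [hz0 i, ENNReal.zero_rpow_of_neg (neg_neg_of_pos (hs i))]]
      simp
    rw [this]; exact le_top
  · rw [ENNReal_rpow_neg_sum _ h0 (by simpa using hz)]
    refine Finset.prod_le_prod' fun i _ => ?_
    rw [ENNReal.rpow_neg, ENNReal.rpow_neg]
    gcongr
    · exact (hs i).le
    · exact Finset.single_le_sum (fun _ _ => zero_le) (Finset.mem_univ i)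

/-- The upper limits imposed on the s_i add up to D = mn - (1 - 1/m) n ∑ q_i, which exceeds mn - a
because n ∑ q_i < a. Shrinking all limits by the common factor (mn - a)/D < 1 gives the required
sum. -/
theorem exists_exponent_splitting {m n : ℕ} (hn : 0 < n) (hm : 0 < m) {q : Fin m → ℝ}
    (hq0 : ∀ i, 0 ≤ q i) (hq1 : ∀ i, q i ≤ 1) {a : ℝ} (ha : n * ∑ i, q i < a)
    (ha' : a < (m : ℝ) * n) :
    ∃ s : Fin m → ℝ, (∀ i, 0 < s i) ∧ (∀ i, s i < n - (1 - 1 / (m : ℝ)) * (n * q i)) ∧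
      ∑ i, s i = m * n - a := by
  have hm' : (0 : ℝ) < m := by exact_mod_cast hm
  have hn' : (0 : ℝ) < n := by exact_mod_cast hn
  have h1 : 0 < 1 / (m : ℝ) := by positivity
  have h1' : 1 / (m : ℝ) ≤ 1 := by
    rw [div_le_one hm']; exact_mod_cast hm
  have hpos : ∀ i, 0 < (n : ℝ) - (1 - 1 / (m : ℝ)) * (n * q i) := fun i => by
    have : (1 - 1 / (m : ℝ)) * (n * q i) ≤ (1 - 1 / (m : ℝ)) * n := by
      refine mul_le_mul_of_nonneg_left ?_ (by linarith)
      nlinarith [hq1 i]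
    nlinarith
  have hsum : ∑ i, ((n : ℝ) - (1 - 1 / (m : ℝ)) * (n * q i)) =
      m * n - (1 - 1 / (m : ℝ)) * (n * ∑ i, q i) := by
    simp [Finset.sum_sub_distrib, ← Finset.mul_sum]
  set D := (m : ℝ) * n - (1 - 1 / (m : ℝ)) * (n * ∑ i, q i) with hD
  have hnq : 0 ≤ n * ∑ i, q i := mul_nonneg hn'.le (Finset.sum_nonneg fun i _ => hq0 i)
  have hDlt : m * n - a < D := by nlinarith
  have hDpos : 0 < D := by linarith
  refine ⟨fun i => ((n : ℝ) - (1 - 1 / (m : ℝ)) * (n * q i)) * ((m * n - a) / D), fun i => ?_,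
    fun i => ?_, ?_⟩
  · exact mul_pos (hpos i) (div_pos (by linarith) hDpos)
  · exact mul_lt_of_lt_one_right (hpos i) ((div_lt_one hDpos).2 hDlt)
  · rw [← Finset.sum_mul, hsum]; field_simp

/-- Splitting the kernel into one-variable Riesz kernels makes the inner integral at most ∏ J_i(x)
by Tonelli. Hölder with m equal exponents puts each J_i in L^m, which is why the reverse Hölder
order is m. -/
theorem exists_lintegral_multilinear_le {n m : ℕ} (hn : 0 < n) (hm : 0 < m) {p : Fin m → ℝ≥0∞}
    (hp : ∀ i, 1 ≤ p i) {a : ℝ} (ha : n * ∑ i, ((p i)⁻¹).toReal < a) (ha' : a < (m : ℝ) * n)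
    (A : ℝ≥0) :
    ∃ C : ℝ≥0, ∀ (c : RSpace n) (R : ℝ), 0 < R → ∀ h u : Fin m → RSpace n → ℝ,
      (∀ i, AEStronglyMeasurable (h i) volume) → (∀ i, AEStronglyMeasurable (u i) volume) →
      (∀ i, 1 < p i →
        ∫⁻ y in Metric.ball c R, (‖u i y‖ₑ ^ (ENNReal.conjExponent (p i)).toReal) ^ m ≤
          A * ENNReal.ofReal R ^ ((n : ℝ) * (1 - m)) *
            (∫⁻ y in Metric.ball c R, ‖u i y‖ₑ ^ (ENNReal.conjExponent (p i)).toReal) ^ m) →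
      ∫⁻ x in Metric.ball c R, ∫⁻ y in Set.univ.pi fun _ : Fin m => Metric.ball c R,
          (∑ i, ‖x - y i‖ₑ) ^ (-((m : ℝ) * n - a)) * ∏ i, ‖h i (y i)‖ₑ * ‖u i (y i)‖ₑ ≤
        C * ENNReal.ofReal R ^ (n - ((m : ℝ) * n - a)) *
          ∏ i, eLpNorm (h i) (p i) volume *
            eLpNorm (u i) (ENNReal.conjExponent (p i)) (volume.restrict (Metric.ball c R)) := by
  have hm' : (0 : ℝ) < m := by exact_mod_cast hm
  have : Nonempty (Fin m) := ⟨⟨0, hm⟩⟩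
  obtain ⟨s, hs0, hs, hsum⟩ := exists_exponent_splitting hn hm (q := fun i => ((p i)⁻¹).toReal)
    (fun i => ENNReal.toReal_nonneg)
    (fun i => by
      rw [← ENNReal.toReal_one]
      exact ENNReal.toReal_mono (by simp) (ENNReal.inv_le_one.2 (hp i))) ha ha'
  choose C hC using fun i => exists_lintegral_fractional_pow_le hn hm (hp i) (hs0 i) (hs i) A
  refine ⟨∏ i, C i ^ (1 / (m : ℝ)), fun c R hR h u hh hu hRH => ?_⟩
  have key := fun i => hC i c R hR (h i) (u i) (hh i) (hu i) (hRH i)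
  rw [volume_pi, Measure.restrict_pi_pi]
  set ν := volume.restrict (Metric.ball c R)
  set J : Fin m → RSpace n → ℝ≥0∞ := fun i x =>
    ∫⁻ y, ‖h i y‖ₑ * ‖u i y‖ₑ * ‖x - y‖ₑ ^ (-(s i)) ∂ν with hJ
  have hhu : ∀ i, AEMeasurable (fun y => ‖h i y‖ₑ * ‖u i y‖ₑ) ν :=
    fun i => (hh i).restrict.enorm.mul (hu i).restrict.enorm
  have hJm : ∀ i, AEMeasurable (J i) ν := fun i =>
    AEMeasurable.lintegral_prod_right' (aemeasurable_mul_enorm_sub_rpow (hhu i) _)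
  have hm1 : (0 : ℝ) ≤ 1 / m := by positivity
  calc _ ≤ ∫⁻ x, ∏ i, J i x ∂ν := by
        refine lintegral_mono fun x => ?_
        rw [hJ]
        simp only
        rw [← lintegral_fin_prod_eq_prod
          (f := fun i y => ‖h i y‖ₑ * ‖u i y‖ₑ * ‖x - y‖ₑ ^ (-(s i)))
          fun i => (hhu i).mul (by fun_prop)]
        refine lintegral_mono fun y => ?_
        rw [Finset.prod_mul_distrib (g := fun i => ‖x - y i‖ₑ ^ (-(s i))), mul_comm, ← hsum]
        exact mul_le_mul' le_rfl (sum_rpow_neg_le_prod hs0 fun i => by simp)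
    _ = ∫⁻ x, ∏ i, (J i x ^ m) ^ (1 / m : ℝ) ∂ν := by
        simp only [← ENNReal.rpow_natCast, ← ENNReal.rpow_mul, mul_one_div_cancel hm'.ne',
          ENNReal.rpow_one]
    _ ≤ ∏ i, (∫⁻ x, J i x ^ m ∂ν) ^ (1 / m : ℝ) :=
        ENNReal.lintegral_prod_norm_pow_le _ (fun i _ => (hJm i).pow_const m)
          (by simp [hm'.ne']) fun _ _ => hm1
    _ ≤ ∏ i, (C i * (ENNReal.ofReal R ^ ((n : ℝ) / m - s i) * eLpNorm (h i) (p i) volume *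
          eLpNorm (u i) (ENNReal.conjExponent (p i)) ν) ^ m) ^ (1 / m : ℝ) :=
        Finset.prod_le_prod' fun i _ => ENNReal.rpow_le_rpow (key i) hm1
    _ = ∏ i, (C i ^ (1 / m : ℝ) : ℝ≥0) * (ENNReal.ofReal R ^ ((n : ℝ) / m - s i) *
          (eLpNorm (h i) (p i) volume * eLpNorm (u i) (ENNReal.conjExponent (p i)) ν)) := by
        refine Finset.prod_congr rfl fun i _ => ?_
        rw [ENNReal.mul_rpow_of_nonneg _ _ hm1, ENNReal.coe_rpow_of_nonneg _ hm1,
          ← ENNReal.rpow_natCast, ← ENNReal.rpow_mul, mul_one_div_cancel hm'.ne',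
          ENNReal.rpow_one, mul_assoc (_ ^ _)]
    _ = _ := by
        have he : n - ((m : ℝ) * n - a) = ∑ i, ((n : ℝ) / m - s i) := by
          rw [Finset.sum_sub_distrib, hsum]
          simp; field_simp
        rw [he, ofReal_rpow_sum _ hR, Finset.prod_mul_distrib, Finset.prod_mul_distrib,
          ENNReal.ofNNReal_finsetProd]
        ring

/-! ### Pointwise bounds for the commutator kernel -/

theorem abs_prod_le_pow_card {ι : Type*} (t : Finset ι) {a : ι → ℝ} {M : ℝ}
    (ha : ∀ i, |a i| ≤ M) : |∏ i ∈ t, a i| ≤ M ^ t.card := by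
  rw [Finset.abs_prod, ← Finset.prod_const]
  exact Finset.prod_le_prod (fun _ _ => abs_nonneg _) fun i _ => ha i

/-- Telescoping, one factor at a time. The extra M on the left avoids the exponent card - 1. -/
theorem abs_prod_sub_prod_le {ι : Type*} (t : Finset ι) {a b : ι → ℝ} {M e : ℝ} (hM : 0 ≤ M)
    (ha : ∀ i, |a i| ≤ M) (hb : ∀ i, |b i| ≤ M) (hab : ∀ i, |a i - b i| ≤ e) :
    M * |∏ i ∈ t, a i - ∏ i ∈ t, b i| ≤ t.card * M ^ t.card * e := by
  classical
  induction t using Finset.induction_on with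
  | empty => simp
  | insert j t hj ih =>
    rw [Finset.prod_insert hj, Finset.prod_insert hj, Finset.card_insert_of_notMem hj]
    have hpa : |∏ i ∈ t, a i| ≤ M ^ t.card := abs_prod_le_pow_card t ha
    have hsplit : a j * ∏ i ∈ t, a i - b j * ∏ i ∈ t, b i =
        (a j - b j) * ∏ i ∈ t, a i + b j * (∏ i ∈ t, a i - ∏ i ∈ t, b i) := by ring
    have he : 0 ≤ e := (abs_nonneg _).trans (hab j)
    calc M * |a j * ∏ i ∈ t, a i - b j * ∏ i ∈ t, b i|
        ≤ M * (|a j - b j| * |∏ i ∈ t, a i| + |b j| * |∏ i ∈ t, a i - ∏ i ∈ t, b i|) := by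
          rw [hsplit, ← abs_mul, ← abs_mul]
          exact mul_le_mul_of_nonneg_left (abs_add_le _ _) hM
      _ = M * (|a j - b j| * |∏ i ∈ t, a i|) +
            |b j| * (M * |∏ i ∈ t, a i - ∏ i ∈ t, b i|) := by ring
      _ ≤ M * (e * M ^ t.card) + M * (t.card * M ^ t.card * e) := by
          have := hab j
          have := hb j
          gcongr
      _ = _ := by push_cast; ring

theorem exists_uniform_lipschitz {m n : ℕ} {δ : ℝ} {b : Fin m → RSpace n → ℝ}
    (hb : ∀ i, MemLipschitz δ (b i)) :
    ∃ L : ℝ, 0 < L ∧ ∀ i x y, |b i x - b i y| ≤ L * ‖x - y‖ ^ δ := by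
  choose L hL using hb
  refine ⟨1 + ∑ i, |L i|, by positivity, fun i x y => (hL i x y).trans ?_⟩
  gcongr
  have := Finset.single_le_sum (f := fun i => |L i|) (fun _ _ => abs_nonneg _) (Finset.mem_univ i)
  have := le_abs_self (L i)
  linarith

theorem norm_sub_le_sum {m n : ℕ} (x : RSpace n) (y : Fin m → RSpace n) (i : Fin m) :
    ‖x - y i‖ ≤ ∑ j, ‖x - y j‖ :=
  Finset.single_le_sum (f := fun j => ‖x - y j‖) (fun _ _ => norm_nonneg _) (Finset.mem_univ i)

/-- Each difference of b_i is O(S^δ), so m of them turn α into α + mδ. On the diagonal S = 0 the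
size condition is silent, but there the product of differences vanishes. -/
theorem exists_enorm_kernel_mul_prod_le {m n : ℕ} (hm : 0 < m) {α δ : ℝ} (hδ : 0 < δ)
    {K : RSpace n → (Fin m → RSpace n) → ℝ} (hK : KernelSize α K) {b : Fin m → RSpace n → ℝ}
    (hb : ∀ i, MemLipschitz δ (b i)) :
    ∃ C : ℝ≥0, ∀ x y, ‖K x y * ∏ i, (b i x - b i (y i))‖ₑ ≤
      C * (∑ i, ‖x - y i‖ₑ) ^ (-((m : ℝ) * n - (α + m * δ))) := by
  obtain ⟨A, hA⟩ := hK
  obtain ⟨L, hL, hbL⟩ := exists_uniform_lipschitz hb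
  refine ⟨(|A| * L ^ m).toNNReal, fun x y => ?_⟩
  set S := ∑ i, ‖x - y i‖ with hS
  have hSe : ∑ i, ‖x - y i‖ₑ = ENNReal.ofReal S := by
    rw [hS, ENNReal.ofReal_sum_of_nonneg fun _ _ => norm_nonneg _]
    simp
  rcases (Finset.sum_nonneg fun i _ => norm_nonneg (x - y i) : 0 ≤ S).eq_or_lt with h0 | hpos
  · have : x = y ⟨0, hm⟩ := by
      rw [← sub_eq_zero, ← norm_eq_zero]
      exact le_antisymm ((norm_sub_le_sum x y _).trans_eq h0.symm) (norm_nonneg _)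
    have hprod : ∏ i, (b i x - b i (y i)) = 0 :=
      Finset.prod_eq_zero (Finset.mem_univ ⟨0, hm⟩) (by rw [← this, sub_self])
    simp [hprod]
  · have hprod : |∏ i, (b i x - b i (y i))| ≤ (L * S ^ δ) ^ m := by
      refine (abs_prod_le_pow_card _ (M := L * S ^ δ) fun i => (hbL i _ _).trans ?_).trans_eq
        (by simp)
      gcongr
      exact norm_sub_le_sum x y i
    have hreal : |K x y * ∏ i, (b i x - b i (y i))| ≤
        |A| * L ^ m * S ^ (-((m : ℝ) * n - (α + m * δ))) := by
      rw [abs_mul]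
      calc _ ≤ (|A| / S ^ ((m : ℝ) * n - α)) * (L * S ^ δ) ^ m := by
            refine mul_le_mul ((hA x y hpos).trans ?_) hprod (abs_nonneg _) (by positivity)
            gcongr
            exact le_abs_self A
        _ = _ := by
            rw [mul_pow, ← Real.rpow_natCast (S ^ δ), ← Real.rpow_mul hpos.le, div_eq_mul_inv,
              ← Real.rpow_neg hpos.le]
            have : -((m : ℝ) * n - (α + m * δ)) = -((m : ℝ) * n - α) + δ * m := by ring
            rw [this, Real.rpow_add hpos]; ring
    rw [hSe, ENNReal.ofReal_rpow_of_pos hpos, Real.enorm_eq_ofReal_abs]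
    change _ ≤ ENNReal.ofReal (|A| * L ^ m) * _
    rw [← ENNReal.ofReal_mul (by positivity)]
    exact ENNReal.ofReal_le_ofReal hreal

/-- Let d = |x - x'|. Changing K costs (d/S)^γ, at most (d/S)^δ since d < S and δ < γ. Changing the
product replaces one factor S^δ by d^δ, which also costs (d/S)^δ. -/
theorem exists_kernel_mul_prod_sub_le {m n : ℕ} {α γ δ : ℝ} (hδ : 0 < δ) (hδγ : δ < γ)
    {K : RSpace n → (Fin m → RSpace n) → ℝ} (hK : KernelSize α K) (hK' : KernelSmooth α γ K)
    {b : Fin m → RSpace n → ℝ} (hb : ∀ i, MemLipschitz δ (b i)) :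
    ∃ C : ℝ, 0 ≤ C ∧ ∀ x x' y, 2 * ‖x - x'‖ < ∑ i, ‖x - y i‖ →
      |K x y * ∏ i, (b i x - b i (y i)) - K x' y * ∏ i, (b i x' - b i (y i))| ≤
        C * ‖x - x'‖ ^ δ * (∑ i, ‖x - y i‖) ^ (-((m : ℝ) * n - (α + m * δ) + δ)) := by
  obtain ⟨A, hA⟩ := hK
  obtain ⟨A', hA'⟩ := hK'
  obtain ⟨L, hL, hbL⟩ := exists_uniform_lipschitz hb
  refine ⟨(|A'| + |A| * m) * (L * 2 ^ δ) ^ m, by positivity, fun x x' y hxy => ?_⟩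
  have hyS := norm_sub_le_sum x y
  have hd0 := norm_nonneg (x - x')
  have hA := hA x y
  have hA' := hA' x x' y hxy
  have hbLx := fun i => hbL i x x'
  have hdS : ∀ i, ‖x' - y i‖ ≤ ‖x - x'‖ + ‖x - y i‖ := fun i => by
    have := norm_sub_le_norm_sub_add_norm_sub x' x (y i)
    rwa [norm_sub_rev x' x] at this
  generalize ‖x - x'‖ = d at *
  generalize ∑ i, ‖x - y i‖ = S at *
  have hSpos : 0 < S := by linarith
  -- A common bound for all differences of the b_i at x and at x', since |x' - y_i| ≤ d + S ≤ 2S.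
  obtain ⟨M, hM⟩ : ∃ M, M = L * 2 ^ δ * S ^ δ := ⟨_, rfl⟩
  have hMpos : 0 < M := by rw [hM]; positivity
  have hM' : M = L * (2 * S) ^ δ := by
    rw [hM, Real.mul_rpow two_pos.le hSpos.le]; ring
  have hbx : ∀ i, |b i x - b i (y i)| ≤ M := fun i => by
    refine (hbL i _ _).trans ?_
    rw [hM']
    gcongr
    linarith [hyS i]
  have hbx' : ∀ i, |b i x' - b i (y i)| ≤ M := fun i => by
    refine (hbL i _ _).trans ?_
    rw [hM']
    gcongr
    linarith [hyS i, hdS i]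
  have hdiff : ∀ i, |(b i x - b i (y i)) - (b i x' - b i (y i))| ≤ L * d ^ δ := fun i => by
    rw [sub_sub_sub_cancel_right]; exact hbLx i
  have hprod' : |∏ i, (b i x' - b i (y i))| ≤ M ^ m :=
    (abs_prod_le_pow_card _ hbx').trans_eq (by simp)
  have hpd := abs_prod_sub_prod_le Finset.univ hMpos.le hbx hbx' hdiff
  simp only [Finset.card_univ, Fintype.card_fin] at hpd
  set Px := ∏ i, (b i x - b i (y i))
  set Px' := ∏ i, (b i x' - b i (y i))
  have hpd' : |Px - Px'| ≤ m * M ^ m * (d ^ δ * S ^ (-δ)) := by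
    have h1 : |Px - Px'| ≤ m * M ^ m * (L * d ^ δ) / M := by
      rw [le_div_iff₀ hMpos]; linarith
    refine h1.trans ?_
    rw [mul_div_assoc]
    gcongr
    rw [div_le_iff₀ hMpos, hM]
    have h2 : (1 : ℝ) ≤ 2 ^ δ := Real.one_le_rpow one_le_two hδ.le
    have h3 : S ^ (-δ) * S ^ δ = 1 := by rw [← Real.rpow_add hSpos]; simp
    calc L * d ^ δ = L * d ^ δ * 1 := by ring
      _ ≤ L * d ^ δ * 2 ^ δ := by gcongr
      _ = L * d ^ δ * 2 ^ δ * (S ^ (-δ) * S ^ δ) := by rw [h3, mul_one]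
      _ = _ := by ring
  have hK1 : |K x y| ≤ |A| * S ^ (-((m : ℝ) * n - α)) := by
    refine (hA hSpos).trans ?_
    rw [Real.rpow_neg hSpos.le, ← div_eq_mul_inv]
    gcongr
    exact le_abs_self A
  have hdγ : d ^ γ ≤ d ^ δ * S ^ (γ - δ) := by
    have : γ = δ + (γ - δ) := by ring
    conv_lhs => rw [this]
    rw [Real.rpow_add_of_nonneg hd0 hδ.le (by linarith)]
    gcongr
    · linarith
  have hK2 : |K x y - K x' y| ≤ |A'| * d ^ δ * S ^ (-((m : ℝ) * n - α + δ)) := by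
    refine hA'.trans ?_
    have e : -((m : ℝ) * n - α + δ) = (γ - δ) + -((m : ℝ) * n - α + γ) := by ring
    rw [e, Real.rpow_add hSpos (γ - δ), Real.rpow_neg hSpos.le, div_eq_mul_inv]
    rw [← mul_assoc, mul_assoc |A'|]
    gcongr
    exact le_abs_self A'
  have hMm : M ^ m = (L * 2 ^ δ) ^ m * S ^ (m * δ) := by
    rw [hM, mul_pow, ← Real.rpow_natCast (S ^ δ), ← Real.rpow_mul hSpos.le, mul_comm δ]
  have hsplit : K x y * Px - K x' y * Px' = (K x y - K x' y) * Px' + K x y * (Px - Px') := by ring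
  have e1 : S ^ (-((m : ℝ) * n - (α + m * δ) + δ)) =
      S ^ (-((m : ℝ) * n - α + δ)) * S ^ (m * δ) := by
    rw [← Real.rpow_add hSpos]; congr 1; ring
  have e2 : S ^ (-((m : ℝ) * n - (α + m * δ) + δ)) =
      S ^ (-((m : ℝ) * n - α)) * S ^ (-δ) * S ^ (m * δ) := by
    rw [← Real.rpow_add hSpos, ← Real.rpow_add hSpos]; congr 1; ring
  rw [hsplit]
  calc _ ≤ |K x y - K x' y| * |Px'| + |K x y| * |Px - Px'| := by
        rw [← abs_mul, ← abs_mul]; exact abs_add_le _ _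
    _ ≤ (|A'| * d ^ δ * S ^ (-((m : ℝ) * n - α + δ))) * M ^ m +
          (|A| * S ^ (-((m : ℝ) * n - α))) * (m * M ^ m * (d ^ δ * S ^ (-δ))) := by
        gcongr
    _ = |A'| * (L * 2 ^ δ) ^ m * d ^ δ * (S ^ (-((m : ℝ) * n - α + δ)) * S ^ (m * δ)) +
          |A| * m * (L * 2 ^ δ) ^ m * d ^ δ *
            (S ^ (-((m : ℝ) * n - α)) * S ^ (-δ) * S ^ (m * δ)) := by
        rw [hMm]; ring
    _ = _ := by rw [← e1, ← e2]; ring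

/-! ### The far piece -/

theorem lintegral_enorm_mul_le_eLpNorm_conjExponent {X : Type*} [MeasurableSpace X] {μ : Measure X}
    {p : ℝ≥0∞} (hp : 1 ≤ p) {h g : X → ℝ} (hh : AEStronglyMeasurable h μ)
    (hg : AEStronglyMeasurable g μ) :
    ∫⁻ x, ‖h x‖ₑ * ‖g x‖ₑ ∂μ ≤ eLpNorm h p μ * eLpNorm g (ENNReal.conjExponent p) μ := by
  have : ENNReal.HolderConjugate p (ENNReal.conjExponent p) :=
    ENNReal.HolderConjugate.conjExponent hp
  have := eLpNorm_smul_le_mul_eLpNorm (p := p) (q := ENNReal.conjExponent p) (r := 1) hg hh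
  simpa [eLpNorm_one_eq_lintegral_enorm] using this

theorem productCommutatorIntegrand_eq {m n : ℕ} (K : RSpace n → (Fin m → RSpace n) → ℝ)
    (b f : Fin m → RSpace n → ℝ) (x : RSpace n) (y : Fin m → RSpace n) :
    productCommutatorIntegrand K b f x y =
      (K x y * ∏ i, (b i x - b i (y i))) * ∏ i, f i (y i) := by
  rw [productCommutatorIntegrand, Finset.prod_mul_distrib, mul_assoc]

theorem enorm_finset_prod {ι : Type*} (t : Finset ι) (a : ι → ℝ) :
    ‖∏ i ∈ t, a i‖ₑ = ∏ i ∈ t, ‖a i‖ₑ := by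
  classical
  induction t using Finset.induction_on with
  | empty => simp
  | insert j t hj ih => rw [Finset.prod_insert hj, Finset.prod_insert hj, enorm_mul, ih]

theorem volume_real_ball_rpow_inv {n : ℕ} (hn : 0 < n) (c : RSpace n) {r : ℝ} (hr : 0 < r) :
    volume.real (Metric.ball c r) ^ ((1 : ℝ) / n) =
      r * volume.real (Metric.ball (0 : RSpace n) 1) ^ ((1 : ℝ) / n) := by
  have hn' : (n : ℝ) ≠ 0 := by exact_mod_cast hn.ne'
  rw [measureReal_def, volume_ball_eq c hr, ENNReal.toReal_mul,
    ENNReal.ofReal_rpow_of_pos hr, ENNReal.toReal_ofReal (by positivity),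
    Real.mul_rpow (by positivity) ENNReal.toReal_nonneg, ← Real.rpow_mul hr.le,
    mul_one_div_cancel hn', Real.rpow_one, measureReal_def]

/-- Some y_j is at distance at least 6r from c, hence S > 5r. This exceeds 2|x - x'| < 4r, as the
smoothness condition requires, and absorbs every multiple of r. -/
theorem add_norm_le_mul_sum_of_far {m n : ℕ} {c x : RSpace n} {r V : ℝ} (hV : 0 ≤ V)
    (hx : x ∈ Metric.ball c r) {y : Fin m → RSpace n}
    (hy : y ∈ (Set.univ.pi fun _ : Fin m => Metric.ball c (6 * r))ᶜ) :
    5 * r < ∑ i, ‖x - y i‖ ∧ ∀ i, r * V + ‖c - y i‖ ≤ (V + 2) * ∑ i, ‖x - y i‖ := by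
  obtain ⟨j, hj⟩ : ∃ j, 6 * r ≤ ‖c - y j‖ := by
    simp only [Set.mem_compl_iff, Set.mem_pi, Set.mem_univ, true_implies, not_forall,
      Metric.mem_ball, not_lt] at hy
    obtain ⟨j, hj⟩ := hy
    exact ⟨j, by rwa [← dist_eq_norm, dist_comm]⟩
  rw [Metric.mem_ball, dist_eq_norm, norm_sub_rev] at hx
  have htri : ∀ i, ‖c - y i‖ ≤ ‖c - x‖ + ‖x - y i‖ :=
    fun i => norm_sub_le_norm_sub_add_norm_sub c x (y i)
  have h5 : 5 * r < ∑ i, ‖x - y i‖ := by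
    linarith [htri j, norm_sub_le_sum x y j]
  have hr : 0 < r := (norm_nonneg _).trans_lt hx
  refine ⟨h5, fun i => ?_⟩
  have := htri i
  have := norm_sub_le_sum x y i
  nlinarith

/-- S^(-∑ e_i) is split as ∏ S^(-e_i), and in the i-th factor S is replaced by the tail weight at
y_i. The integrand becomes a tensor product, and Hölder applies to f_i = (f_i v_i) v_i^(-1) in each
variable. -/
theorem exists_lintegral_far_le {m n : ℕ} (hn : 0 < n) {α γ δ : ℝ} (hδ : 0 < δ)
    (hδγ : δ < γ) {K : RSpace n → (Fin m → RSpace n) → ℝ} (hK : KernelSize α K)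
    (hK' : KernelSmooth α γ K) {b : Fin m → RSpace n → ℝ} (hb : ∀ i, MemLipschitz δ (b i))
    {p : Fin m → ℝ≥0∞} (hp : ∀ i, 1 ≤ p i) {e : Fin m → ℝ} (he : ∀ i, 0 < e i)
    (hesum : ∑ i, e i = (m : ℝ) * n - (α + m * δ) + δ) :
    ∃ C : ℝ≥0, ∀ (c : RSpace n) (r : ℝ), 0 < r → ∀ x ∈ Metric.ball c r, ∀ x' ∈ Metric.ball c r,
      ∀ f v : Fin m → RSpace n → ℝ, (∀ i, AEStronglyMeasurable (fun y => f i y * v i y) volume) →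
      (∀ i, AEStronglyMeasurable (v i) volume) → (∀ i, ∀ᵐ y, v i y ≠ 0) →
      ∫⁻ y in (Set.univ.pi fun _ : Fin m => Metric.ball c (6 * r))ᶜ,
          ‖productCommutatorIntegrand K b f x y - productCommutatorIntegrand K b f x' y‖ₑ ≤
        C * ENNReal.ofReal r ^ δ * ∏ i, eLpNorm (fun y => f i y * v i y) (p i) volume *
          eLpNorm (fun y => (v i y)⁻¹ /
            (volume.real (Metric.ball c r) ^ ((1 : ℝ) / n) + ‖c - y‖) ^ e i)
            (ENNReal.conjExponent (p i)) volume := by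
  obtain ⟨C, hC0, hC⟩ := exists_kernel_mul_prod_sub_le hδ hδγ hK hK' hb
  set V : ℝ := volume.real (Metric.ball (0 : RSpace n) 1) ^ ((1 : ℝ) / n) with hVdef
  have hV : 0 < V := Real.rpow_pos_of_pos
    (ENNReal.toReal_pos (Metric.measure_ball_pos _ _ one_pos).ne' measure_ball_lt_top.ne) _
  refine ⟨(C * 2 ^ δ * ∏ i, (V + 2) ^ e i).toNNReal, fun c r hr x hx x' hx' f v hfv hv hv0 => ?_⟩
  rw [volume_real_ball_rpow_inv hn c hr, ← hVdef]
  set D : RSpace n → ℝ := fun y => r * V + ‖c - y‖ with hD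
  have hDpos : ∀ y, 0 < D y := fun y => by positivity
  have hDmeas : Measurable D := by fun_prop
  have hpt : ∀ y ∈ (Set.univ.pi fun _ : Fin m => Metric.ball c (6 * r))ᶜ,
      ‖productCommutatorIntegrand K b f x y - productCommutatorIntegrand K b f x' y‖ₑ ≤
        ENNReal.ofReal (C * 2 ^ δ * ∏ i, (V + 2) ^ e i) * ENNReal.ofReal r ^ δ *
          ∏ i, ‖f i (y i)‖ₑ * ‖(D (y i) ^ e i)⁻¹‖ₑ := by
    intro y hy
    obtain ⟨h5, hfar⟩ := add_norm_le_mul_sum_of_far hV.le hx hy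
    have hd : ‖x - x'‖ ≤ 2 * r := by
      rw [Metric.mem_ball] at hx hx'
      rw [← dist_eq_norm]
      linarith [dist_triangle_right x x' c]
    have hker := hC x x' y (by linarith)
    have hSpos : 0 < ∑ i, ‖x - y i‖ := by linarith
    have hreal : |K x y * ∏ i, (b i x - b i (y i)) - K x' y * ∏ i, (b i x' - b i (y i))| ≤
        (C * 2 ^ δ * ∏ i, (V + 2) ^ e i) * r ^ δ * ∏ i, (D (y i) ^ e i)⁻¹ := by
      refine hker.trans ?_
      have h1 : (∑ i, ‖x - y i‖) ^ (-((m : ℝ) * n - (α + m * δ) + δ)) ≤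
          ∏ i, ((V + 2) ^ e i * (D (y i) ^ e i)⁻¹) := by
        rw [← hesum, ← Finset.sum_neg_distrib, Real.rpow_sum_of_pos hSpos]
        refine Finset.prod_le_prod (fun i _ => by positivity) fun i _ => ?_
        rw [Real.rpow_neg hSpos.le, ← div_eq_mul_inv, inv_le_comm₀ (by positivity)
          (div_pos (by positivity) (Real.rpow_pos_of_pos (hDpos _) _)), inv_div,
          ← Real.div_rpow (hDpos _).le (by positivity)]
        refine Real.rpow_le_rpow (div_nonneg (hDpos _).le (by positivity)) ?_ (he i).le
        rw [div_le_iff₀' (by positivity)]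
        exact hfar i
      have h2 : ‖x - x'‖ ^ δ ≤ 2 ^ δ * r ^ δ := by
        rw [← Real.mul_rpow two_pos.le hr.le]; gcongr
      rw [Finset.prod_mul_distrib] at h1
      calc _ ≤ C * (2 ^ δ * r ^ δ) * ((∏ i, (V + 2) ^ e i) * ∏ i, (D (y i) ^ e i)⁻¹) := by
            gcongr
        _ = _ := by ring
    rw [productCommutatorIntegrand_eq, productCommutatorIntegrand_eq, ← sub_mul, enorm_mul,
      enorm_finset_prod, Finset.prod_mul_distrib, mul_comm (∏ i, ‖f i (y i)‖ₑ), ← mul_assoc]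
    refine mul_le_mul' ?_ le_rfl
    rw [← enorm_finset_prod, Real.enorm_eq_ofReal_abs, Real.enorm_of_nonneg
      (Finset.prod_nonneg fun i _ => inv_nonneg.2 (Real.rpow_nonneg (hDpos _).le _)),
      ENNReal.ofReal_rpow_of_pos hr, ← ENNReal.ofReal_mul (by positivity),
      ← ENNReal.ofReal_mul (by positivity)]
    exact ENNReal.ofReal_le_ofReal hreal
  have hmeasC : MeasurableSet (Set.univ.pi fun _ : Fin m => Metric.ball c (6 * r))ᶜ :=
    (MeasurableSet.univ_pi fun _ => measurableSet_ball).compl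
  have hg : ∀ i, AEStronglyMeasurable (fun y => (v i y)⁻¹ / D y ^ e i) volume := fun i =>
    ((hv i).aemeasurable.inv.div (by fun_prop)).aestronglyMeasurable
  have hae : ∀ i, (fun y => ‖f i y‖ₑ * ‖(D y ^ e i)⁻¹‖ₑ) =ᵐ[volume]
      fun y => ‖f i y * v i y‖ₑ * ‖(v i y)⁻¹ / D y ^ e i‖ₑ := fun i => by
    filter_upwards [hv0 i] with y hy
    rw [← enorm_mul, ← enorm_mul]
    congr 1
    field_simp
  calc _ ≤ ∫⁻ y in (Set.univ.pi fun _ : Fin m => Metric.ball c (6 * r))ᶜ,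
        ENNReal.ofReal (C * 2 ^ δ * ∏ i, (V + 2) ^ e i) * ENNReal.ofReal r ^ δ *
          ∏ i, ‖f i (y i)‖ₑ * ‖(D (y i) ^ e i)⁻¹‖ₑ := setLIntegral_mono' hmeasC hpt
    _ ≤ ∫⁻ y : Fin m → RSpace n,
        ENNReal.ofReal (C * 2 ^ δ * ∏ i, (V + 2) ^ e i) * ENNReal.ofReal r ^ δ *
          ∏ i, ‖f i (y i)‖ₑ * ‖(D (y i) ^ e i)⁻¹‖ₑ := setLIntegral_le_lintegral _ _
    _ = ENNReal.ofReal (C * 2 ^ δ * ∏ i, (V + 2) ^ e i) * ENNReal.ofReal r ^ δ *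
          ∏ i, ∫⁻ y, ‖f i y‖ₑ * ‖(D y ^ e i)⁻¹‖ₑ := by
        rw [lintegral_const_mul' _ _
          (ENNReal.mul_ne_top ENNReal.ofReal_ne_top (ofReal_rpow_ne_top hr _)), volume_pi,
          lintegral_fin_prod_eq_prod (f := fun i y => ‖f i y‖ₑ * ‖(D y ^ e i)⁻¹‖ₑ) fun i =>
            ((hfv i).enorm.mul (hg i).enorm).congr (hae i).symm]
    _ ≤ _ := by
        refine mul_le_mul' le_rfl (Finset.prod_le_prod' fun i _ => ?_)
        rw [lintegral_congr_ae (hae i)]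
        exact lintegral_enorm_mul_le_eLpNorm_conjExponent (hp i) (hfv i) (hg i)

/-! ### The local piece -/

theorem exists_reverseHolder_lintegral {m n : ℕ} (hm : 0 < m) {q : ℝ} {v : RSpace n → ℝ}
    (hv : ∀ᵐ x, 0 < v x) (hRH : ReverseHolder m fun x => v x ^ (-q)) :
    ∃ A : ℝ≥0, ∀ (c : RSpace n) (R : ℝ), 0 < R →
      ∫⁻ y in Metric.ball c R, (‖(v y)⁻¹‖ₑ ^ q) ^ m ≤
        A * ENNReal.ofReal R ^ ((n : ℝ) * (1 - m)) *
          (∫⁻ y in Metric.ball c R, ‖(v y)⁻¹‖ₑ ^ q) ^ m := by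
  obtain ⟨A, hA⟩ := hRH
  have hm' : (0 : ℝ) < m := by exact_mod_cast hm
  set W := volume (Metric.ball (0 : RSpace n) 1) with hW
  have hW0 : W ≠ 0 := (Metric.measure_ball_pos _ _ one_pos).ne'
  have hWt : W ≠ ∞ := measure_ball_lt_top.ne
  refine ⟨A ^ m * (W ^ (1 - m : ℝ)).toNNReal, fun c R hR => ?_⟩
  have hae : ∀ᵐ y ∂(volume.restrict (Metric.ball c R)),
      ENNReal.ofReal (v y ^ (-q)) = ‖(v y)⁻¹‖ₑ ^ q := by
    refine ae_restrict_of_ae ?_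
    filter_upwards [hv] with y hy
    rw [Real.enorm_of_nonneg (inv_nonneg.2 hy.le), ENNReal.ofReal_rpow_of_pos (inv_pos.2 hy),
      Real.rpow_neg hy.le, Real.inv_rpow hy.le]
  have h := hA c R hR
  rw [setLAverage_eq, setLAverage_eq, lintegral_congr_ae hae] at h
  have hae' : ∀ᵐ y ∂(volume.restrict (Metric.ball c R)),
      ENNReal.ofReal (v y ^ (-q)) ^ (m : ℝ) = (‖(v y)⁻¹‖ₑ ^ q) ^ m := by
    filter_upwards [hae] with y hy
    rw [hy, ENNReal.rpow_natCast]
  rw [lintegral_congr_ae hae'] at h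
  set I := ∫⁻ y in Metric.ball c R, (‖(v y)⁻¹‖ₑ ^ q) ^ m
  set I' := ∫⁻ y in Metric.ball c R, ‖(v y)⁻¹‖ₑ ^ q
  set B := volume (Metric.ball c R) with hB
  have hB0 : B ≠ 0 := (Metric.measure_ball_pos _ _ hR).ne'
  have hBt : B ≠ ∞ := measure_ball_lt_top.ne
  have h' := pow_le_pow_left' h m
  rw [← ENNReal.rpow_natCast, ← ENNReal.rpow_mul, one_div_mul_cancel hm'.ne', ENNReal.rpow_one,
    ENNReal.div_le_iff hB0 hBt] at h'
  refine h'.trans_eq ?_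
  have hBp : B ^ (1 - m : ℝ) = B * (B⁻¹) ^ m := by
    rw [sub_eq_add_neg, ENNReal.rpow_add _ _ hB0 hBt, ENNReal.rpow_one, ENNReal.rpow_neg,
      ENNReal.rpow_natCast, ENNReal.inv_pow]
  have hBe : B ^ (1 - m : ℝ) = ENNReal.ofReal R ^ ((n : ℝ) * (1 - m)) * W ^ (1 - m : ℝ) := by
    rw [hB, volume_ball_eq c hR, ENNReal.mul_rpow_of_ne_top (ofReal_rpow_ne_top hR _) hWt,
      ← ENNReal.rpow_mul]
  rw [ENNReal.coe_mul, ENNReal.coe_toNNReal (by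
    simp [ENNReal.rpow_eq_top_iff, hW0, hWt]), ENNReal.coe_pow]
  calc _ = A ^ m * (B * (B⁻¹) ^ m) * I' ^ m := by
        rw [div_eq_mul_inv, mul_pow, mul_pow]; ring
    _ = _ := by rw [← hBp, hBe]; ring

/-- The `L^q` norm of `u` on a ball is controlled by its norm against the tail weight. -/
theorem exists_eLpNorm_restrict_ball_le {n : ℕ} (hn : 0 < n) {e : ℝ} (he : 0 < e) (q : ℝ≥0∞) :
    ∃ C : ℝ≥0, ∀ (c : RSpace n) (r : ℝ), 0 < r → ∀ u : RSpace n → ℝ,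
      eLpNorm u q (volume.restrict (Metric.ball c (6 * r))) ≤
        C * ENNReal.ofReal r ^ e * eLpNorm (fun y => u y /
            (volume.real (Metric.ball c r) ^ ((1 : ℝ) / n) + ‖c - y‖) ^ e) q volume := by
  set V : ℝ := volume.real (Metric.ball (0 : RSpace n) 1) ^ ((1 : ℝ) / n) with hVdef
  have hV : 0 < V := Real.rpow_pos_of_pos
    (ENNReal.toReal_pos (Metric.measure_ball_pos _ _ one_pos).ne' measure_ball_lt_top.ne) _
  refine ⟨((V + 6) ^ e).toNNReal, fun c r hr u => ?_⟩
  rw [volume_real_ball_rpow_inv hn c hr, ← hVdef]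
  have hle : ∀ᵐ y ∂(volume.restrict (Metric.ball c (6 * r))),
      ‖u y‖ ≤ ((V + 6) ^ e * r ^ e) * ‖u y / (r * V + ‖c - y‖) ^ e‖ := by
    filter_upwards [ae_restrict_mem measurableSet_ball] with y hy
    rw [Metric.mem_ball, dist_comm, dist_eq_norm] at hy
    have hD : 0 < r * V + ‖c - y‖ := by positivity
    rw [norm_div, Real.norm_of_nonneg (Real.rpow_nonneg hD.le _), ← Real.mul_rpow (by positivity)
      hr.le, ← mul_div_assoc, le_div_iff₀ (Real.rpow_pos_of_pos hD _), mul_comm]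
    gcongr
    nlinarith
  refine (eLpNorm_le_mul_eLpNorm_of_ae_le_mul hle q).trans ?_
  rw [ENNReal.ofReal_mul (by positivity), ENNReal.ofReal_rpow_of_pos hr]
  gcongr
  · exact le_rfl
  · exact Measure.restrict_le_self

theorem exists_lintegral_local_le {m n : ℕ} (hm : 0 < m) (hn : 0 < n) {α δ : ℝ} (hδ : 0 < δ)
    {K : RSpace n → (Fin m → RSpace n) → ℝ} (hK : KernelSize α K)
    {b : Fin m → RSpace n → ℝ} (hb : ∀ i, MemLipschitz δ (b i))
    {p : Fin m → ℝ≥0∞} (hp : ∀ i, 1 ≤ p i) {e : Fin m → ℝ} (he : ∀ i, 0 < e i)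
    (hesum : ∑ i, e i = (m : ℝ) * n - (α + m * δ) + δ)
    (ha : n * ∑ i, ((p i)⁻¹).toReal < α + m * δ) (ha' : α + m * δ < (m : ℝ) * n)
    {v : Fin m → RSpace n → ℝ} (hv : ∀ i, AEStronglyMeasurable (v i) volume)
    (hvpos : ∀ i, ∀ᵐ y, 0 < v i y)
    (hRH : ∀ i, 1 < p i →
      ReverseHolder m (fun x => v i x ^ (-(ENNReal.conjExponent (p i)).toReal))) :
    ∃ C : ℝ≥0, ∀ (c : RSpace n) (r : ℝ), 0 < r →
      ∀ f : Fin m → RSpace n → ℝ, (∀ i, AEStronglyMeasurable (fun y => f i y * v i y) volume) →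
      ∫⁻ x in Metric.ball c (6 * r), ∫⁻ y in Set.univ.pi fun _ : Fin m => Metric.ball c (6 * r),
          ‖productCommutatorIntegrand K b f x y‖ₑ ≤
        C * ENNReal.ofReal r ^ (n + δ) * ∏ i, eLpNorm (fun y => f i y * v i y) (p i) volume *
          eLpNorm (fun y => (v i y)⁻¹ /
            (volume.real (Metric.ball c r) ^ ((1 : ℝ) / n) + ‖c - y‖) ^ e i)
            (ENNReal.conjExponent (p i)) volume := by
  obtain ⟨C₀, hC₀⟩ := exists_enorm_kernel_mul_prod_le hm hδ hK hb
  have hA : ∀ i, ∃ A : ℝ≥0, 1 < p i → ∀ (c : RSpace n) (R : ℝ), 0 < R →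
      ∫⁻ y in Metric.ball c R, (‖(v i y)⁻¹‖ₑ ^ (ENNReal.conjExponent (p i)).toReal) ^ m ≤
        A * ENNReal.ofReal R ^ ((n : ℝ) * (1 - m)) *
          (∫⁻ y in Metric.ball c R, ‖(v i y)⁻¹‖ₑ ^ (ENNReal.conjExponent (p i)).toReal) ^ m := by
    intro i
    by_cases hi : 1 < p i
    · obtain ⟨A, hA⟩ := exists_reverseHolder_lintegral hm (hvpos i) (hRH i hi)
      exact ⟨A, fun _ => hA⟩
    · exact ⟨0, fun h => absurd h hi⟩
  choose A hA using hA
  -- The sum of the reverse Hölder constants serves all indices at once.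
  obtain ⟨C₁, hC₁⟩ := exists_lintegral_multilinear_le hn hm hp ha ha' (∑ i, A i)
  choose C₂ hC₂ using fun i =>
    exists_eLpNorm_restrict_ball_le hn (he i) (ENNReal.conjExponent (p i))
  refine ⟨C₀ * C₁ * (ENNReal.ofReal 6 ^ (n - ((m : ℝ) * n - (α + m * δ)))).toNNReal * ∏ i, C₂ i,
    fun c r hr f hfv => ?_⟩
  have h6 : 0 < 6 * r := by positivity
  have hu : ∀ i, AEStronglyMeasurable (fun y => (v i y)⁻¹) volume :=
    fun i => (hv i).aemeasurable.inv.aestronglyMeasurable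
  have key := hC₁ c (6 * r) h6 (fun i y => f i y * v i y) (fun i y => (v i y)⁻¹) hfv hu
    fun i hi => (hA i hi c (6 * r) h6).trans (by
      gcongr
      exact Finset.single_le_sum (fun _ _ => zero_le) (Finset.mem_univ i))
  have hae : ∀ᵐ y : Fin m → RSpace n, ∀ i,
      ‖f i (y i) * v i (y i)‖ₑ * ‖(v i (y i))⁻¹‖ₑ = ‖f i (y i)‖ₑ := by
    rw [ae_all_iff]
    intro i
    have h1 : ∀ᵐ t, ‖f i t * v i t‖ₑ * ‖(v i t)⁻¹‖ₑ = ‖f i t‖ₑ := by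
      filter_upwards [hvpos i] with t ht
      rw [← enorm_mul, mul_inv_cancel_right₀ ht.ne']
    exact (Measure.quasiMeasurePreserving_eval (fun _ : Fin m => (volume : Measure (RSpace n)))
      i).ae h1
  calc _ ≤ ∫⁻ x in Metric.ball c (6 * r),
        C₀ * ∫⁻ y in Set.univ.pi fun _ : Fin m => Metric.ball c (6 * r),
          (∑ i, ‖x - y i‖ₑ) ^ (-((m : ℝ) * n - (α + m * δ))) *
            ∏ i, ‖f i (y i) * v i (y i)‖ₑ * ‖(v i (y i))⁻¹‖ₑ := by
        refine lintegral_mono fun x => ?_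
        rw [← lintegral_const_mul' _ _ ENNReal.coe_ne_top]
        refine lintegral_mono_ae (ae_restrict_of_ae ?_)
        filter_upwards [hae] with y hy
        rw [productCommutatorIntegrand_eq, enorm_mul, enorm_finset_prod,
          Finset.prod_congr rfl fun i _ => hy i, ← mul_assoc]
        exact mul_le_mul' (hC₀ x y) le_rfl
    _ ≤ C₀ * (C₁ * ENNReal.ofReal (6 * r) ^ (n - ((m : ℝ) * n - (α + m * δ))) *
          ∏ i, eLpNorm (fun y => f i y * v i y) (p i) volume *
            eLpNorm (fun y => (v i y)⁻¹) (ENNReal.conjExponent (p i))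
              (volume.restrict (Metric.ball c (6 * r)))) := by
        rw [lintegral_const_mul' _ _ ENNReal.coe_ne_top]
        exact mul_le_mul' le_rfl key
    _ ≤ C₀ * (C₁ * ENNReal.ofReal (6 * r) ^ (n - ((m : ℝ) * n - (α + m * δ))) *
          ∏ i, (C₂ i * ENNReal.ofReal r ^ e i) *
            (eLpNorm (fun y => f i y * v i y) (p i) volume *
            eLpNorm (fun y => (v i y)⁻¹ /
              (volume.real (Metric.ball c r) ^ ((1 : ℝ) / n) + ‖c - y‖) ^ e i)
              (ENNReal.conjExponent (p i)) volume)) := by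
        refine mul_le_mul' le_rfl (mul_le_mul' le_rfl (Finset.prod_le_prod' fun i _ => ?_))
        refine (mul_le_mul' le_rfl (hC₂ i c r hr fun y => (v i y)⁻¹)).trans_eq ?_
        ring
    _ = _ := by
        -- The fractional integral contributes r^(n - (mn - α̃)) and removing the tail weights r^(∑
        -- e_i); together r^(n + δ).
        have hexp : (n : ℝ) + δ = (n - ((m : ℝ) * n - (α + m * δ))) + ∑ i, e i := by
          rw [hesum]; ring
        rw [hexp, ofReal_rpow_add hr, ofReal_rpow_sum _ hr, Finset.prod_mul_distrib,
          Finset.prod_mul_distrib, ENNReal.ofReal_mul (by norm_num),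
          ENNReal.mul_rpow_of_ne_top (by simp) (by simp), ENNReal.coe_mul, ENNReal.coe_mul,
          ENNReal.coe_mul, ENNReal.ofNNReal_finsetProd,
          ENNReal.coe_toNNReal (ofReal_rpow_ne_top (by norm_num) _)]
        ring

/-! ### Mean oscillation of integrals taken modulo constants -/

/-- A set average is at a mean distance bounded by the mean oscillation. -/
theorem enorm_sub_setAverage_le {X : Type*} [MeasurableSpace X] {μ : Measure X} {s : Set X}
    (h0 : μ s ≠ 0) (ht : μ s ≠ ∞) {g : X → ℝ} (hg : IntegrableOn g s μ) (a : ℝ) :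
    ‖a - ⨍ z in s, g z ∂μ‖ₑ ≤ (μ s)⁻¹ * ∫⁻ z in s, ‖a - g z‖ₑ ∂μ := by
  have hpos : 0 < μ.real s := ENNReal.toReal_pos h0 ht
  have hconst : IntegrableOn (fun _ : X => a) s μ := integrableOn_const ht
  have h1 : a - ⨍ z in s, g z ∂μ = (μ.real s)⁻¹ * ∫ z in s, (a - g z) ∂μ := by
    rw [integral_sub hconst hg, setAverage_eq, setIntegral_const, smul_eq_mul, smul_eq_mul]
    field_simp
  rw [h1, enorm_mul, Real.enorm_of_nonneg (inv_nonneg.2 hpos.le), ENNReal.ofReal_inv_of_pos hpos,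
    ofReal_measureReal ht]
  exact mul_le_mul' le_rfl (enorm_integral_le_lintegral_enorm _)

theorem exists_nat_mem_ball {n : ℕ} (x z : RSpace n) :
    ∃ N : ℕ, x ∈ Metric.ball (0 : RSpace n) (N + 1) ∧ z ∈ Metric.ball (0 : RSpace n) (N + 1) := by
  obtain ⟨N, hN⟩ := exists_nat_gt (max ‖x‖ ‖z‖)
  refine ⟨N, ?_, ?_⟩ <;> rw [mem_ball_zero_iff]
  · linarith [le_max_left ‖x‖ ‖z‖]
  · linarith [le_max_right ‖x‖ ‖z‖]

/-- An integral operator modulo constants: if the kernel `F` is integrable near the diagonal and its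
differences are integrable away from it, with bounds `Φ`, then the regularized integral has mean
oscillation controlled by `Φ`. -/
theorem ae_integrable_sub_and_oscillation_le {m n : ℕ}
    {F : RSpace n → (Fin m → RSpace n) → ℝ}
    (hF : AEStronglyMeasurable (Function.uncurry F) (volume.prod volume))
    {Φ : RSpace n → ℝ → ℝ≥0∞} (hΦ : ∀ c r, 0 < r → Φ c r ≠ ∞)
    (hloc : ∀ (c : RSpace n) (r : ℝ), 0 < r →
      ∫⁻ x in Metric.ball c r, ∫⁻ y in Set.univ.pi fun _ : Fin m => Metric.ball c (6 * r),
        ‖F x y‖ₑ ≤ volume (Metric.ball c r) * Φ c r)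
    (hfar : ∀ (c : RSpace n) (r : ℝ), 0 < r → ∀ x ∈ Metric.ball c r, ∀ x' ∈ Metric.ball c r,
      ∫⁻ y in (Set.univ.pi fun _ : Fin m => Metric.ball c (6 * r))ᶜ, ‖F x y - F x' y‖ₑ ≤ Φ c r) :
    ∀ᵐ z : RSpace n, (∀ᵐ x : RSpace n, Integrable (fun y => F x y - F z y) volume) ∧
      LocallyIntegrable (fun x => ∫ y, (F x y - F z y)) volume ∧
      ∀ (c : RSpace n) (r : ℝ), 0 < r →
        ∫⁻ x in Metric.ball c r, ‖(∫ y, (F x y - F z y)) -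
          ⨍ t in Metric.ball c r, ∫ y, (F t y - F z y)‖ₑ ≤
            3 * (volume (Metric.ball c r) * Φ c r) := by
  set Q : RSpace n → ℝ → Set (Fin m → RSpace n) :=
    fun c r => Set.univ.pi fun _ : Fin m => Metric.ball c (6 * r) with hQ
  have hQm : ∀ c r, MeasurableSet (Q c r) := fun c r =>
    MeasurableSet.univ_pi fun _ => measurableSet_ball
  have hFx : ∀ᵐ x : RSpace n, AEStronglyMeasurable (F x) volume := hF.prodMk_left
  set l : RSpace n → ℝ → RSpace n → ℝ≥0∞ := fun c r x => ∫⁻ y in Q c r, ‖F x y‖ₑ with hl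
  have hlm : ∀ c r, AEMeasurable (l c r) volume := fun c r => by
    have h := (hF.mono_measure (Measure.prod_mono le_rfl
      (Measure.restrict_le_self (s := Q c r)))).enorm
    exact AEMeasurable.lintegral_prod_right' h
  have hlfin : ∀ c r, 0 < r → ∀ᵐ x, x ∈ Metric.ball c r → l c r x < ∞ := by
    intro c r hr
    rw [← ae_restrict_iff' measurableSet_ball]
    refine ae_lt_top' (hlm c r).restrict ((hloc c r hr).trans_lt ?_).ne
    exact ENNReal.mul_lt_top measure_ball_lt_top (hΦ c r hr).lt_top
  have hgood : ∀ᵐ x : RSpace n, AEStronglyMeasurable (F x) volume ∧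
      ∀ N : ℕ, x ∈ Metric.ball (0 : RSpace n) (N + 1) → l 0 (N + 1) x < ∞ :=
    hFx.and (ae_all_iff.2 fun N => hlfin 0 (N + 1) (by positivity))
  -- Countably many balls about the origin exhaust the space, so this set of good points has full
  -- measure. For two good points inside one such ball, F(x, ·) and F(z, ·) are each integrable near
  -- it, and their difference is integrable far from it.
  set G : Set (RSpace n) := {x | AEStronglyMeasurable (F x) volume ∧
      ∀ N : ℕ, x ∈ Metric.ball (0 : RSpace n) (N + 1) → l 0 (N + 1) x < ∞} with hG
  have hint : ∀ x ∈ G, ∀ z ∈ G, Integrable (fun y => F x y - F z y) volume := by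
    intro x hx z hz
    obtain ⟨N, hxN, hzN⟩ := exists_nat_mem_ball x z
    have hN : (0 : ℝ) < N + 1 := by positivity
    rw [← integrableOn_univ, ← Set.union_compl_self (Q 0 (N + 1))]
    refine IntegrableOn.union ?_ ?_
    · exact Integrable.sub ⟨hx.1.restrict, hx.2 N hxN⟩ ⟨hz.1.restrict, hz.2 N hzN⟩
    · exact ⟨(hx.1.sub hz.1).restrict,
        (hfar 0 (N + 1) hN x hxN z hzN).trans_lt (hΦ 0 _ hN).lt_top⟩
  filter_upwards [hgood] with z hz
  set g : RSpace n → ℝ := fun x => ∫ y, (F x y - F z y) with hg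
  have hgm : AEStronglyMeasurable g volume := by
    have h2 : AEStronglyMeasurable (fun q : RSpace n × (Fin m → RSpace n) => F q.1 q.2 - F z q.2)
        (volume.prod volume) := hF.sub hz.1.comp_snd
    exact h2.integral_prod_right'
  have hosc : ∀ (c : RSpace n) (r : ℝ), 0 < r → ∀ x ∈ G, ∀ x' ∈ G, x ∈ Metric.ball c r →
      x' ∈ Metric.ball c r → ‖g x - g x'‖ₑ ≤ l c r x + l c r x' + Φ c r := by
    intro c r hr x hx x' hx' hxB hxB'
    have h1 : g x - g x' = ∫ y, (F x y - F x' y) := by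
      rw [hg]
      simp only
      rw [← integral_sub (hint x hx z hz) (hint x' hx' z hz)]
      simp
    rw [h1]
    refine (enorm_integral_le_lintegral_enorm _).trans ?_
    rw [← lintegral_add_compl _ (hQm c r)]
    refine add_le_add ?_ (hfar c r hr x hxB x' hxB')
    rw [hl]
    simp only
    rw [← lintegral_add_left' hx.1.restrict.enorm]
    exact lintegral_mono fun y => enorm_sub_le
  have hint_g : ∀ (c : RSpace n) (r : ℝ), 0 < r → IntegrableOn g (Metric.ball c r) volume := by
    intro c r hr
    have hB0 : volume (Metric.ball c r) ≠ 0 := (Metric.measure_ball_pos _ _ hr).ne'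
    -- Comparison with one good base point bounds |g| on the ball by l plus a finite constant.
    obtain ⟨x₀, hx₀B, hx₀G, hx₀l⟩ : ∃ x₀ ∈ Metric.ball c r, x₀ ∈ G ∧ l c r x₀ < ∞ := by
      have h : ∃ᵐ x, x ∈ Metric.ball c r := by
        rw [frequently_ae_iff]; exact hB0
      obtain ⟨x, hxB, hxG, hxl⟩ := (h.and_eventually (hgood.and (hlfin c r hr))).exists
      exact ⟨x, hxB, hxG, hxl hxB⟩
    refine ⟨hgm.restrict, ?_⟩
    calc ∫⁻ x in Metric.ball c r, ‖g x‖ₑ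
        ≤ ∫⁻ x in Metric.ball c r, (l c r x + (l c r x₀ + Φ c r + ‖g x₀‖ₑ)) := by
          refine lintegral_mono_ae ?_
          filter_upwards [ae_restrict_mem measurableSet_ball, ae_restrict_of_ae hgood] with x hxB hx
          calc ‖g x‖ₑ = ‖(g x - g x₀) + g x₀‖ₑ := by rw [sub_add_cancel]
            _ ≤ ‖g x - g x₀‖ₑ + ‖g x₀‖ₑ := enorm_add_le _ _
            _ ≤ (l c r x + l c r x₀ + Φ c r) + ‖g x₀‖ₑ := by
                gcongr
                exact hosc c r hr x hx x₀ hx₀G hxB hx₀B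
            _ = _ := by ring
      _ = (∫⁻ x in Metric.ball c r, l c r x) +
            (l c r x₀ + Φ c r + ‖g x₀‖ₑ) * volume (Metric.ball c r) := by
          rw [lintegral_add_right _ measurable_const, setLIntegral_const]
      _ < ∞ := by
          have hV : volume (Metric.ball c r) < ∞ := measure_ball_lt_top
          refine ENNReal.add_lt_top.2 ⟨(hloc c r hr).trans_lt
            (ENNReal.mul_lt_top hV (hΦ c r hr).lt_top), ENNReal.mul_lt_top ?_ hV⟩
          exact ENNReal.add_lt_top.2 ⟨ENNReal.add_lt_top.2 ⟨hx₀l, (hΦ c r hr).lt_top⟩,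
            enorm_lt_top⟩
  refine ⟨?_, ?_, ?_⟩
  · filter_upwards [hgood] with x hx using hint x hx z hz
  · intro x
    exact ⟨Metric.ball x 1, Metric.ball_mem_nhds x one_pos,
      hint_g x 1 one_pos⟩
  · intro c r hr
    set B := Metric.ball c r with hB
    have hB0 : volume B ≠ 0 := (Metric.measure_ball_pos _ _ hr).ne'
    have hBt : volume B ≠ ∞ := measure_ball_lt_top.ne
    have hLB : ∫⁻ x in B, l c r x ≤ volume B * Φ c r := hloc c r hr
    -- Averaging the pointwise oscillation bound over t gives one Φ from the mean of l and one from
    -- the far piece. Integrating l in x adds the third.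
    have hpt : ∀ᵐ x ∂(volume.restrict B), ‖g x - ⨍ t in B, g t‖ₑ ≤ l c r x + 2 * Φ c r := by
      filter_upwards [ae_restrict_mem measurableSet_ball, ae_restrict_of_ae hgood] with x hxB hx
      refine (enorm_sub_setAverage_le hB0 hBt (hint_g c r hr) (g x)).trans ?_
      calc (volume B)⁻¹ * ∫⁻ t in B, ‖g x - g t‖ₑ
          ≤ (volume B)⁻¹ * ∫⁻ t in B, (l c r t + (l c r x + Φ c r)) := by
            refine mul_le_mul' le_rfl (lintegral_mono_ae ?_)
            filter_upwards [ae_restrict_mem measurableSet_ball, ae_restrict_of_ae hgood]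
              with t htB ht
            refine (hosc c r hr x hx t ht hxB htB).trans_eq ?_
            ring
        _ = (volume B)⁻¹ * ((∫⁻ t in B, l c r t) + (l c r x + Φ c r) * volume B) := by
            rw [lintegral_add_right _ measurable_const, setLIntegral_const]
        _ ≤ (volume B)⁻¹ * (volume B * Φ c r + (l c r x + Φ c r) * volume B) := by gcongr
        _ = ((volume B)⁻¹ * volume B) * (l c r x + 2 * Φ c r) := by ring
        _ = l c r x + 2 * Φ c r := by rw [ENNReal.inv_mul_cancel hB0 hBt, one_mul]
    calc _ ≤ ∫⁻ x in B, (l c r x + 2 * Φ c r) := lintegral_mono_ae hpt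
      _ = (∫⁻ x in B, l c r x) + 2 * Φ c r * volume B := by
          rw [lintegral_add_right _ measurable_const, setLIntegral_const]
      _ ≤ volume B * Φ c r + 2 * Φ c r * volume B := by gcongr
      _ = _ := by ring

/-! ### Integral representation of the product commutator -/

/-- Induction from the right end of the list, because the last entry is the outermost commutator.
The tuple f must vary, since that commutator evaluates the inner operator both at f and at f with
b_j f_j in slot j. -/
theorem foldl_entryCommutator_eq {m n : ℕ} (K : RSpace n → (Fin m → RSpace n) → ℝ)
    (b : Fin m → RSpace n → ℝ) (x : RSpace n) (l : List (Fin m)) (hl : l.Nodup)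
    (f : Fin m → RSpace n → ℝ)
    (hf : ∀ s ⊆ l.toFinset, Integrable (fun y : Fin m → RSpace n =>
      K x y * ∏ i, if i ∈ s then b i (y i) * f i (y i) else f i (y i)) volume) :
    Integrable (fun y : Fin m → RSpace n =>
      K x y * ((l.map fun i => b i x - b i (y i)).prod * ∏ i, f i (y i))) volume ∧
    l.foldl (fun S j => entryCommutator (b j) S j) (kernelOp K) f x =
      ∫ y : Fin m → RSpace n,
        K x y * ((l.map fun i => b i x - b i (y i)).prod * ∏ i, f i (y i)) := by
  induction l using List.reverseRecOn generalizing f with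
  | nil =>
    refine ⟨?_, ?_⟩
    · simpa using hf ∅ (by simp)
    · simp [kernelOp]
  | append_singleton l j ih =>
    have hj : j ∉ l := by
      rw [List.nodup_append] at hl
      intro h
      exact hl.2.2 j h j (by simp) rfl
    have hl' : l.Nodup := (List.nodup_append.1 hl).1
    set f' := Function.update f j (fun y => b j y * f j y) with hf'
    have hprod : ∀ y : Fin m → RSpace n, ∏ i, f' i (y i) = b j (y j) * ∏ i, f i (y i) := by
      intro y
      rw [← Finset.mul_prod_erase _ _ (Finset.mem_univ j),
        ← Finset.mul_prod_erase _ (fun i => f i (y i)) (Finset.mem_univ j), hf',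
        Function.update_self, mul_assoc]
      congr 2
      refine Finset.prod_congr rfl fun i hi => ?_
      rw [Function.update_of_ne (Finset.ne_of_mem_erase hi)]
    obtain ⟨h1, h1'⟩ := ih hl' f fun s hs => hf s (hs.trans (by simp))
    -- A choice s for the modified tuple is the choice `insert j s` for f; j is not in s because the
    -- list has no repetitions.
    obtain ⟨h2, h2'⟩ := ih hl' f' fun s hs => by
      have hjs : j ∉ s := fun h => hj (by simpa using hs h)
      refine (hf (insert j s) ?_).congr (Filter.Eventually.of_forall fun y => ?_)
      · intro i hi
        rcases Finset.mem_insert.1 hi with rfl | hi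
        · simp
        · have := hs hi
          simp only [List.mem_toFinset] at this
          simp [this]
      · simp only
        congr 1
        refine Finset.prod_congr rfl fun i _ => ?_
        rcases eq_or_ne i j with rfl | hij
        · simp [hjs, hf']
        · simp [hij, hf']
    have hsplit : ∀ y : Fin m → RSpace n,
        K x y * (((l ++ [j]).map fun i => b i x - b i (y i)).prod * ∏ i, f i (y i)) =
        b j x * (K x y * ((l.map fun i => b i x - b i (y i)).prod * ∏ i, f i (y i))) -
          K x y * ((l.map fun i => b i x - b i (y i)).prod * ∏ i, f' i (y i)) := by
      intro y
      rw [hprod]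
      simp only [List.map_append, List.prod_append, List.map_cons, List.map_nil,
        List.prod_singleton]
      ring
    simp only [hsplit]
    refine ⟨(h1.const_mul _).sub h2, ?_⟩
    rw [integral_sub (h1.const_mul _) h2, integral_const_mul, ← h1', ← h2', List.foldl_append]
    rfl

theorem ae_productCommutator_eq_integral {m n : ℕ} {K : RSpace n → (Fin m → RSpace n) → ℝ}
    {b f : Fin m → RSpace n → ℝ} (h : ProductCommutatorDefined K b f) :
    ∀ᵐ x : RSpace n, Integrable (productCommutatorIntegrand K b f x) volume ∧
      productCommutator K b f x = ∫ y, productCommutatorIntegrand K b f x y := by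
  have h' : ∀ᵐ x : RSpace n, ∀ s : Finset (Fin m), Integrable (fun y : Fin m → RSpace n =>
      K x y * ∏ i, if i ∈ s then b i (y i) * f i (y i) else f i (y i)) volume :=
    ae_all_iff.2 h
  filter_upwards [h'] with x hx
  have key := foldl_entryCommutator_eq K b x (List.finRange m) (List.nodup_finRange m) f
    fun s _ => hx s
  have e : ∀ y : Fin m → RSpace n, productCommutatorIntegrand K b f x y =
      K x y * (((List.finRange m).map fun i => b i x - b i (y i)).prod * ∏ i, f i (y i)) := by
    intro y
    rw [productCommutatorIntegrand_eq, Fin.prod_univ_def (fun i => b i x - b i (y i)), mul_assoc]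
  refine ⟨key.1.congr (Filter.Eventually.of_forall fun y => (e y).symm), ?_⟩
  simp only [e]
  exact key.2

/-! ### Measurability, invariance under constants, normalizations -/

theorem MemLipschitz.continuous {n : ℕ} {δ : ℝ} (hδ : 0 < δ) {b : RSpace n → ℝ}
    (hb : MemLipschitz δ b) : Continuous b := by
  obtain ⟨A, hA⟩ := hb
  refine continuous_iff_continuousAt.2 fun x => ?_
  rw [ContinuousAt, tendsto_iff_norm_sub_tendsto_zero]
  have hlim : Filter.Tendsto (fun y : RSpace n => A * ‖y - x‖ ^ δ) (nhds x) (nhds 0) := by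
    have hc : Continuous fun y : RSpace n => A * ‖y - x‖ ^ δ :=
      continuous_const.mul ((continuous_id.sub continuous_const).norm.rpow_const
        fun _ => Or.inr hδ.le)
    simpa [Real.zero_rpow hδ.ne'] using hc.tendsto x
  exact squeeze_zero (fun _ => norm_nonneg _) (fun y => hA y x) hlim

theorem aestronglyMeasurable_productCommutatorIntegrand {m n : ℕ}
    {K : RSpace n → (Fin m → RSpace n) → ℝ}
    (hK : AEStronglyMeasurable (Function.uncurry K) (volume.prod volume))
    {b f : Fin m → RSpace n → ℝ} (hb : ∀ i, Continuous (b i))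
    (hf : ∀ i, AEStronglyMeasurable (f i) volume) :
    AEStronglyMeasurable (Function.uncurry (productCommutatorIntegrand K b f))
      (volume.prod volume) := by
  refine hK.mul (Finset.aestronglyMeasurable_fun_prod _ fun i _ => AEStronglyMeasurable.mul ?_ ?_)
  · have : Continuous fun q : RSpace n × (Fin m → RSpace n) => b i q.1 - b i (q.2 i) :=
      ((hb i).comp continuous_fst).sub
        ((hb i).comp ((continuous_apply i).comp continuous_snd))
    exact this.aestronglyMeasurable
  · exact ((hf i).comp_quasiMeasurePreserving
      (Measure.quasiMeasurePreserving_eval (fun _ : Fin m => (volume : Measure (RSpace n)))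
        i)).comp_snd

theorem aestronglyMeasurable_of_mul_weight {n : ℕ} {f v : RSpace n → ℝ}
    (hfv : AEStronglyMeasurable (fun x => f x * v x) volume)
    (hv : AEStronglyMeasurable v volume) (hpos : ∀ᵐ x, 0 < v x) :
    AEStronglyMeasurable f volume := by
  refine ((hfv.aemeasurable.mul hv.aemeasurable.inv).congr ?_).aestronglyMeasurable
  filter_upwards [hpos] with x hx
  simp [hx.ne']

theorem WeightedLipschitzBound.congr_add_const {n : ℕ} {w : RSpace n → ℝ} {τ : ℝ}
    {g g' : RSpace n → ℝ} {M : ℝ≥0∞} (hg : WeightedLipschitzBound w τ g M) {a : ℝ}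
    (h : ∀ᵐ x, g' x = g x + a) : WeightedLipschitzBound w τ g' M := by
  have hint : ∀ c r, IntegrableOn g (Metric.ball c r) volume := fun c r =>
    (hg.1.integrableOn_isCompact (isCompact_closedBall c r)).mono_set Metric.ball_subset_closedBall
  have hconst : ∀ c r, IntegrableOn (fun _ : RSpace n => a) (Metric.ball c r) volume :=
    fun c r => integrableOn_const measure_ball_lt_top.ne
  have hint' : ∀ c r, IntegrableOn g' (Metric.ball c r) volume := fun c r =>
    ((hint c r).add (hconst c r)).congr (ae_restrict_of_ae (by
      filter_upwards [h] with x hx using hx.symm))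
  refine ⟨fun x => ⟨Metric.ball x 1, Metric.ball_mem_nhds x one_pos, hint' x 1⟩,
    fun c r hr => ?_⟩
  refine le_trans (le_of_eq ?_) (hg.2 c r hr)
  congr 1
  have havg : ⨍ z in Metric.ball c r, g' z = (⨍ z in Metric.ball c r, g z) + a := by
    have hpos : 0 < volume.real (Metric.ball c r) :=
      ENNReal.toReal_pos (Metric.measure_ball_pos _ _ hr).ne' measure_ball_lt_top.ne
    rw [setAverage_eq, setAverage_eq, integral_congr_ae (ae_restrict_of_ae h),
      integral_add (hint c r) (hconst c r), setIntegral_const]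
    simp only [smul_eq_mul]
    field_simp
  refine lintegral_congr_ae (ae_restrict_of_ae ?_)
  filter_upwards [h] with x hx
  rw [havg, hx, add_sub_add_right_eq_sub]

theorem supNormOn_ball_ne_zero {n : ℕ} {w : RSpace n → ℝ} (hw : ∀ᵐ x, 0 < w x) (c : RSpace n)
    {r : ℝ} (hr : 0 < r) (hwm : AEStronglyMeasurable w volume) :
    supNormOn w (Metric.ball c r) ≠ 0 := by
  intro h
  rw [supNormOn, eLpNorm_eq_zero_iff (hwm.indicator measurableSet_ball) (by simp)] at h
  refine (Metric.measure_ball_pos volume c hr).ne' ?_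
  rw [measure_eq_zero_iff_ae_notMem]
  filter_upwards [h, hw] with x hx hwx hxB
  rw [Set.indicator_of_mem hxB] at hx
  exact hwx.ne' hx

theorem mul_sum_inv_toReal_lt {m n : ℕ} {a : ℝ} (ha : 0 < a) (hn : 0 < n) {p : Fin m → ℝ≥0∞}
    (hp1 : ∀ i, 1 ≤ p i) (hp : ENNReal.ofReal (n / a) < (∑ i, (p i)⁻¹)⁻¹) :
    n * ∑ i, ((p i)⁻¹).toReal < a := by
  have hn' : (0 : ℝ) < n := by exact_mod_cast hn
  have hfin : ∀ i ∈ Finset.univ, (p i)⁻¹ ≠ ∞ := fun i _ => by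
    simpa using (zero_lt_one.trans_le (hp1 i)).ne'
  rw [ENNReal.lt_inv_iff_lt_inv, ← ENNReal.ofReal_inv_of_pos (by positivity), inv_div] at hp
  have h := (ENNReal.lt_ofReal_iff_toReal_lt (ENNReal.sum_ne_top.2 hfin)).1 hp
  rw [ENNReal.toReal_sum hfin, lt_div_iff₀ hn'] at h
  linarith

/-- Since r^δ is |B|^(δ/n) up to a power of the unit ball's volume, the normalization of the
oscillation becomes that of the class ℍ_m. -/
theorem div_volume_ball_rpow_mul_eq {n : ℕ} (hn : 0 < n) (s : ℝ≥0∞) (c : RSpace n) {r : ℝ}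
    (hr : 0 < r) (δ τ : ℝ) :
    s / volume (Metric.ball c r) ^ (1 + τ / n) *
        (volume (Metric.ball c r) * ENNReal.ofReal r ^ δ) =
      volume (Metric.ball (0 : RSpace n) 1) ^ (-(δ / n)) *
        (s / volume (Metric.ball c r) ^ ((τ - δ) / n)) := by
  have hn' : (n : ℝ) ≠ 0 := by exact_mod_cast hn.ne'
  have hW0 : volume (Metric.ball (0 : RSpace n) 1) ≠ 0 :=
    (Metric.measure_ball_pos _ _ one_pos).ne'
  have hWt : volume (Metric.ball (0 : RSpace n) 1) ≠ ∞ := measure_ball_lt_top.ne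
  have hB0 : volume (Metric.ball c r) ≠ 0 := (Metric.measure_ball_pos _ _ hr).ne'
  have hBt : volume (Metric.ball c r) ≠ ∞ := measure_ball_lt_top.ne
  have hr' : ENNReal.ofReal r ^ δ = volume (Metric.ball (0 : RSpace n) 1) ^ (-(δ / n)) *
      volume (Metric.ball c r) ^ (δ / n) := by
    rw [volume_ball_eq c hr, ENNReal.mul_rpow_of_ne_top (ofReal_rpow_ne_top hr _) hWt,
      ← ENNReal.rpow_mul, mul_div_cancel₀ _ hn', mul_left_comm, ← ENNReal.rpow_add _ _ hW0 hWt]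
    simp
  have hB : volume (Metric.ball c r) ^ (-((τ - δ) / n)) =
      volume (Metric.ball c r) ^ (-(1 + τ / n)) * volume (Metric.ball c r) *
        volume (Metric.ball c r) ^ (δ / n) := by
    have hexp : -((τ - δ) / n) = -(1 + τ / n) + 1 + δ / n := by ring
    rw [hexp, ENNReal.rpow_add _ _ hB0 hBt, ENNReal.rpow_add _ _ hB0 hBt, ENNReal.rpow_one]
  rw [ENNReal.div_eq_inv_mul, ENNReal.div_eq_inv_mul, ← ENNReal.rpow_neg, ← ENNReal.rpow_neg, hr', hB]
  ring

/-! ### The main theorem -/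

theorem theorem1p2 (m n : ℕ) (α γ δ δt : ℝ)
    (hα : 0 < α) (hαmn : α < (m : ℝ) * n)
    (hγ : 0 < γ) (hγ1 : γ ≤ 1)
    (hδ : 0 < δ) (hδlt : δ < min γ (((m : ℝ) * n - α) / m))
    (hδt : δt ≤ δ)
    (K : RSpace n → (Fin m → RSpace n) → ℝ)
    (hKmeas : AEStronglyMeasurable (Function.uncurry K) (volume.prod volume))
    (hKsize : KernelSize α K) (hKsmooth : KernelSmooth α γ K)
    (p : Fin m → ℝ≥0∞) (hp1 : ∀ i, 1 ≤ p i)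
    (hp : ENNReal.ofReal (n / (α + m * δ)) < (∑ i, (p i)⁻¹)⁻¹)
    (b : Fin m → RSpace n → ℝ) (hb : ∀ i, MemLipschitz δ (b i))
    (w : RSpace n → ℝ) (v : Fin m → RSpace n → ℝ)
    (hw : IsWeight w) (hv : ∀ i, IsWeight (v i))
    (hH : MemHClass δ p (α + m * δ) δt w v)
    (hRH : ∀ i, 1 < p i →
      ReverseHolder m (fun x => v i x ^ (-(ENNReal.conjExponent (p i)).toReal))) :
    ∃ C : ℝ≥0, 0 < C ∧
      ∀ f : Fin m → RSpace n → ℝ,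
        (∀ i, MemLp (fun x => f i x * v i x) (p i) volume) →
        -- the product commutator of `f`, whenever the integrals in it converge
        (ProductCommutatorDefined K b f →
          WeightedLipschitzBound w δt (productCommutator K b f)
            (C * ∏ i, eLpNorm (fun x => f i x * v i x) (p i) volume)) ∧
        -- for every `f`, the product commutator of `f` modulo constants, normalized at `z`
        (∀ᵐ z : RSpace n,
          (∀ᵐ x : RSpace n, Integrable (fun y : Fin m → RSpace n =>
            productCommutatorIntegrand K b f x y - productCommutatorIntegrand K b f z y) volume) ∧
          WeightedLipschitzBound w δt
            (fun x => ∫ y : Fin m → RSpace n,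
              (productCommutatorIntegrand K b f x y - productCommutatorIntegrand K b f z y))
            (C * ∏ i, eLpNorm (fun x => f i x * v i x) (p i) volume)) := by
  have hmn : 0 < (m : ℝ) * n := hα.trans hαmn
  have hm : 0 < m := Nat.pos_of_ne_zero fun h => by simp [h] at hmn
  have hn : 0 < n := Nat.pos_of_ne_zero fun h => by simp [h] at hmn
  have hm' : (0 : ℝ) < m := by exact_mod_cast hm
  have hδγ : δ < γ := hδlt.trans_le (min_le_left _ _)
  have ha' : α + m * δ < (m : ℝ) * n := by
    have := (lt_div_iff₀ hm').1 (hδlt.trans_le (min_le_right _ _))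
    linarith
  have ha := mul_sum_inv_toReal_lt (by positivity) hn hp1 hp
  obtain ⟨βs, hβ, hβsum, A, hA⟩ := hH
  set e : Fin m → ℝ := fun i => n - βs i + δ / m with he_def
  have he : ∀ i, 0 < e i := fun i => by
    have := (hβ i).2
    have : 0 < δ / m := by positivity
    simp only [he_def]; linarith
  have hesum : ∑ i, e i = (m : ℝ) * n - (α + m * δ) + δ := by
    simp only [he_def]
    rw [Finset.sum_add_distrib, Finset.sum_sub_distrib, hβsum]
    simp only [Finset.sum_const, Finset.card_univ, Fintype.card_fin, nsmul_eq_mul]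
    field_simp
  have hvm : ∀ i, AEStronglyMeasurable (v i) volume := fun i => (hv i).1.aestronglyMeasurable
  obtain ⟨C₁, hC₁⟩ := exists_lintegral_local_le hm hn hδ hKsize hb hp1 he hesum ha ha' hvm
    (fun i => (hv i).2) hRH
  obtain ⟨C₂, hC₂⟩ := exists_lintegral_far_le hn hδ hδγ hKsize hKsmooth hb hp1 he hesum
  set W := volume (Metric.ball (0 : RSpace n) 1) with hW
  have hW0 : W ≠ 0 := (Metric.measure_ball_pos _ _ one_pos).ne'
  have hWt : W ≠ ∞ := measure_ball_lt_top.ne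
  set C₀ : ℝ≥0 := C₁ * W⁻¹.toNNReal + C₂
  have hWinv : ((W⁻¹.toNNReal : ℝ≥0) : ℝ≥0∞) = W⁻¹ :=
    ENNReal.coe_toNNReal (ENNReal.inv_ne_top.2 hW0)
  have hWpow : (((W ^ (-(δ / n))).toNNReal : ℝ≥0) : ℝ≥0∞) = W ^ (-(δ / n)) :=
    ENNReal.coe_toNNReal (by simp [ENNReal.rpow_eq_top_iff, hW0, hWt])
  set N : RSpace n → ℝ → ℝ≥0∞ := fun c r => ∏ i, eLpNorm (fun y => (v i y)⁻¹ /
    (volume.real (Metric.ball c r) ^ ((1 : ℝ) / n) + ‖c - y‖) ^ e i)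
    (ENNReal.conjExponent (p i)) volume with hN
  -- The ℍ_m bound forces finiteness only because the norm of w on the ball is nonzero: in `ℝ≥0∞`
  -- the product 0 * ∞ is 0.
  have hNfin : ∀ c r, 0 < r → N c r ≠ ∞ := by
    intro c r hr htop
    have h := hA c r hr
    change _ * N c r ≤ _ at h
    rw [htop, ENNReal.mul_top] at h
    · exact ENNReal.coe_ne_top (top_le_iff.1 h)
    · refine (ENNReal.div_pos (supNormOn_ball_ne_zero hw.2 c hr hw.1.aestronglyMeasurable) ?_).ne'
      simp [ENNReal.rpow_eq_top_iff, (Metric.measure_ball_pos volume c hr).ne',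
        (measure_ball_lt_top (μ := volume) (x := c) (r := r)).ne]
  -- The 3 comes from the oscillation lemma, the power of W from rewriting r^δ, and A from the ℍ_m
  -- condition; the 1 only ensures positivity.
  refine ⟨3 * C₀ * (W ^ (-(δ / n))).toNNReal * A + 1, by positivity, fun f hf => ?_⟩
  set P := ∏ i, eLpNorm (fun x => f i x * v i x) (p i) volume with hP
  have hPfin : P ≠ ∞ := ENNReal.prod_ne_top fun i _ => (hf i).2.ne
  have hfv : ∀ i, AEStronglyMeasurable (fun x => f i x * v i x) volume := fun i => (hf i).1
  have hmain := ae_integrable_sub_and_oscillation_le (F := productCommutatorIntegrand K b f)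
    (aestronglyMeasurable_productCommutatorIntegrand hKmeas (fun i => (hb i).continuous hδ)
      fun i => aestronglyMeasurable_of_mul_weight (hfv i) (hvm i) (hv i).2)
    (Φ := fun c r => C₀ * ENNReal.ofReal r ^ δ * (P * N c r))
    (fun c r hr => ENNReal.mul_ne_top
      (ENNReal.mul_ne_top ENNReal.coe_ne_top (ofReal_rpow_ne_top hr _))
      (ENNReal.mul_ne_top hPfin (hNfin c r hr)))
    (fun c r hr => by
      refine (lintegral_mono_set (Metric.ball_subset_ball (by linarith : r ≤ 6 * r))).trans
        ((hC₁ c r hr f hfv).trans ?_)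
      rw [Finset.prod_mul_distrib, volume_ball_eq c hr, ofReal_rpow_add hr, ← hW]
      calc C₁ * (ENNReal.ofReal r ^ (n : ℝ) * ENNReal.ofReal r ^ δ) * (P * N c r)
          = ENNReal.ofReal r ^ (n : ℝ) * (W * W⁻¹) *
              (C₁ * ENNReal.ofReal r ^ δ * (P * N c r)) := by
            rw [ENNReal.mul_inv_cancel hW0 hWt]; ring
        _ = ENNReal.ofReal r ^ (n : ℝ) * W *
              ((C₁ * W⁻¹) * ENNReal.ofReal r ^ δ * (P * N c r)) := by ring
        _ ≤ _ := by
            gcongr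
            rw [← hWinv, ← ENNReal.coe_mul, ENNReal.coe_le_coe]
            exact le_self_add)
    (fun c r hr x hx x' hx' => by
      refine (hC₂ c r hr x hx x' hx' f v hfv hvm
        fun i => (hv i).2.mono fun y hy => hy.ne').trans ?_
      rw [Finset.prod_mul_distrib]
      gcongr
      exact le_add_self)
  have hbound : ∀ᵐ z : RSpace n, (∀ᵐ x : RSpace n, Integrable (fun y : Fin m → RSpace n =>
      productCommutatorIntegrand K b f x y - productCommutatorIntegrand K b f z y) volume) ∧
      WeightedLipschitzBound w δt
        (fun x => ∫ y : Fin m → RSpace n,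
          (productCommutatorIntegrand K b f x y - productCommutatorIntegrand K b f z y))
        ((3 * C₀ * (W ^ (-(δ / n))).toNNReal * A + 1 : ℝ≥0) * P) := by
    filter_upwards [hmain] with z hz
    refine ⟨hz.1, hz.2.1, fun c r hr => ?_⟩
    refine (mul_le_mul' le_rfl (hz.2.2 c r hr)).trans ?_
    calc supNormOn w (Metric.ball c r) / volume (Metric.ball c r) ^ (1 + δt / n) *
          (3 * (volume (Metric.ball c r) * (C₀ * ENNReal.ofReal r ^ δ * (P * N c r))))
        = 3 * C₀ * (supNormOn w (Metric.ball c r) / volume (Metric.ball c r) ^ (1 + δt / n) *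
          (volume (Metric.ball c r) * ENNReal.ofReal r ^ δ)) * (P * N c r) := by ring
      _ = 3 * C₀ * W ^ (-(δ / n)) * P * (supNormOn w (Metric.ball c r) /
            volume (Metric.ball c r) ^ ((δt - δ) / n) * N c r) := by
          rw [div_volume_ball_rpow_mul_eq hn _ c hr δ δt]; ring
      _ ≤ 3 * C₀ * W ^ (-(δ / n)) * P * A := by
          gcongr
          exact hA c r hr
      _ = ((3 * C₀ * (W ^ (-(δ / n))).toNNReal * A : ℝ≥0) : ℝ≥0∞) * P := by
          push_cast
          rw [hWpow]; ring
      _ ≤ _ := by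
          gcongr
          exact le_self_add
  refine ⟨fun hdef => ?_, hbound⟩
  have hcomm := ae_productCommutator_eq_integral hdef
  -- At almost every z both facts hold. For one such z the integral of F(z, ·) converges and is the
  -- constant separating the commutator from its normalized version.
  obtain ⟨z, hz, hzF⟩ := (hbound.and hcomm).exists
  refine hz.2.congr_add_const (a := ∫ y, productCommutatorIntegrand K b f z y) ?_
  filter_upwards [hcomm] with x hx
  rw [hx.2, integral_sub hx.1 hzF.1, sub_add_cancel]
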